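/- **Theorem 1.3.** Let $S$ be a connected closed surface with a (finite) triangulation $T$, with vertex set $V$ and face set $F$. For $I\subset V$ let $F_I$ be the set of faces having at least one vertex in $I$. For $k=(k_i)_{i\in V}\in\mathbb R_{>0}^V$ and a face with vertices $i,j,l$ take three mutually externally tangent curves in the hyperbolic plane with constant geodesic curvatures $k_i,k_j,k_l$; a curve of curvature $>1$, $=1$, $<1$ is a circle, a horocycle, a hypercycle, respectively. Such a configuration exists and is unique up to isometry. Let $l_i^{jl}$ be the hyperbolic length of the arc of the $i$-th curve between its two points of tangency that bounds the interstice of the three curves. The total geodesic curvature of $k$ at $i$ is $L_i(k)=k_i\sum l_i^{jl}$, where the sum is over the faces at $i$ (a face with several corners at $i$ contributes once for each). A generalized hyperbolic circle packing metric is a vector $k\in\mathbb R_{>0}^V$ together with the disjoint sets $I_1=\{i: k_i<1\}$ and $I_2=\{i: k_i=1\}$. Let $\hat L\in\mathbb R^V$ and consider the flow $$\frac{dk_i}{dt}=-k_i\,(L_i(k)-\hat L_i),\qquad i\in V,\qquad k(0)=k_0\in\mathbb R_{>0}^V,$$ in $\mathbb R_{>0}^V$. It has a unique solution $k(t)$,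 and this solution exists for all $t\ge 0$. The following two statements are equivalent: (a) $k(t)$ converges to a point of $\mathbb R_{>0}^V$ as $t\to\infty$. (b) $\hat L_i>0$ for every $i\in V$, and $\sum_{i\in I}\hat L_i<\pi|F_I|$ for every nonempty $I\subset V$. If they hold, there is a unique generalized hyperbolic circle packing metric $\hat k$ with $L_i(\hat k)=\hat L_i$ for all $i\in V$, and $k(t)$ converges to it exponentially fast: there are constants $C,\delta>0$ such that $|k_i(t)-\hat k_i|\le C e^{-\delta t}$ for all $t\ge0$ and $i\in V$. -/

import Mathlib

open Filter Topology

noncomputable section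

/-! ### Curves in the upper half-plane model of the hyperbolic plane

The hyperbolic plane is `{z : ℂ | 0 < z.im}` with the metric `|dz|² / (Im z)²`. -/

/-- Hyperbolic length of the arc `γ|[a,b]` of a curve in the upper half-plane
(up to the sign coming from the order of `a` and `b`). -/
def hyperbolicLength (γ : ℝ → ℂ) (a b : ℝ) : ℝ :=
  ∫ t in a..b, ‖deriv γ t‖ / (γ t).im

/-- Geodesic curvature, with respect to the left unit normal, of a regular curve in the upper
half-plane. For the conformal metric `e^{2u}|dz|²` with `u = -log (Im z)` it is
`e^{-u} (κ - ∂ₙ u)`, where `n` is the Euclidean left unit normal and `κ` the Euclidean curvature. -/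
def geodesicCurvature (γ : ℝ → ℂ) (t : ℝ) : ℝ :=
  (γ t).im * ((starRingEnd ℂ (deriv γ t) * deriv (deriv γ) t).im / ‖deriv γ t‖ ^ 3)
    + (deriv γ t).re / ‖deriv γ t‖

/-- The part in the upper half-plane of the Euclidean circle with centre `c` and radius `R` is
nonempty and has constant geodesic curvature `k` (towards the Euclidean disc that it bounds).
For `k > 1` this is a hyperbolic circle, for `k = 1` a horocycle, for `0 < k < 1` a hypercycle. -/
structure IsGeneralizedCircle (c : ℂ) (R k : ℝ) : Prop where
  radius_pos : 0 < R
  nonempty : ∃ θ : ℝ, 0 < (circleMap c R θ).im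
  curvature : ∀ θ : ℝ, 0 < (circleMap c R θ).im → geodesicCurvature (circleMap c R) θ = k

/-- `c`, `R` describe three mutually externally tangent generalized circles of geodesic curvatures
`k 0, k 1, k 2`. (Any three mutually externally tangent circles, horocycles or hypercycles can be
brought into this form, in which each generalized disc is the trace of a bounded Euclidean disc,
by an isometry that moves to `∞` an ideal point which is not an ideal point of one of the discs.
The Euclidean points of tangency automatically lie in the upper half-plane.) -/
structure IsThreeCircleConfiguration (k : Fin 3 → ℝ) (c : Fin 3 → ℂ) (R : Fin 3 → ℝ) : Prop where
  circle : ∀ i, IsGeneralizedCircle (c i) (R i) (k i)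
  tangent : ∀ i j, i ≠ j → dist (c i) (c j) = R i + R j

/-- `ℓ` is the hyperbolic length of the arc of the `i`-th circle between its two points of tangency
in some configuration of three mutually tangent generalized circles with curvatures `k`. The arc is
the one that bounds the interstice of the three circles, that is, the one inside the Euclidean
triangle of the centres; its Euclidean central angle is less than `π`. -/
def IsTangencyArcLength (k : Fin 3 → ℝ) (i : Fin 3) (ℓ : ℝ) : Prop :=
  ∃ (c : Fin 3 → ℂ) (R : Fin 3 → ℝ) (α β : ℝ),
    IsThreeCircleConfiguration k c R ∧
    circleMap (c i) (R i) α ∈ Metric.sphere (c (i + 1)) (R (i + 1)) ∧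
    circleMap (c i) (R i) β ∈ Metric.sphere (c (i + 2)) (R (i + 2)) ∧
    |β - α| < Real.pi ∧
    ℓ = |hyperbolicLength (circleMap (c i) (R i)) α β|

/-- The length `lᵢ(k₀, k₁, k₂)` of the arc of the `i`-th circle between its two points of tangency.
For positive `k` the configuration exists and is unique up to isometry, so that the set below has
exactly one element, which `sInf` picks. -/
def tangencyArcLength (k : Fin 3 → ℝ) (i : Fin 3) : ℝ :=
  sInf {ℓ : ℝ | IsTangencyArcLength k i ℓ}

/-! ### Triangulated closed surfaces -/

/-- The end points of the side `s = (f, c)` of the triangle `f` opposite to its corner `c`,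
as corners of `f`. -/
def sideEndpoint {F : Type*} (s : F × Fin 3) (b : Bool) : F × Fin 3 :=
  (s.1, s.2 + (if b then 1 else 2))

/-- A triangulation, with vertex set `V` and face set `F`, of a connected closed surface: the
surface is obtained from finitely many triangles by gluing their sides in pairs.
Every simplicial triangulation is of this kind; here two triangles may also share several
vertices or sides, and corners of a triangle may be identified with each other. -/
structure TriangulatedSurface (V F : Type*) where
  /-- The side to which a side is glued. -/
  glue : F × Fin 3 → F × Fin 3
  glue_glue : ∀ s, glue (glue s) = s
  glue_ne : ∀ s, glue s ≠ s
  /-- How the end points of a side are matched with those of its partner. -/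
  flip : F × Fin 3 → Bool
  flip_glue : ∀ s, flip (glue s) = flip s
  /-- The vertex at a corner of a face. -/
  vert : F → Fin 3 → V
  /-- Every vertex is the vertex of some face. -/
  vert_surj : ∀ v, ∃ f c, vert f c = v
  /-- Two corners have the same vertex exactly when they are identified by the gluing. -/
  vert_eq_iff : ∀ p q : F × Fin 3, vert p.1 p.2 = vert q.1 q.2 ↔
    Relation.EqvGen (fun p q => ∃ s b, p = sideEndpoint s b ∧
      q = sideEndpoint (glue s) (xor b (flip s))) p q
  face_nonempty : Nonempty F
  connected : ∀ f g, Relation.ReflTransGen (fun f g => ∃ c, (glue (f, c)).1 = g) f g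

namespace TriangulatedSurface

variable {V F : Type*} (T : TriangulatedSurface V F)

/-- `F_I`, the set of faces having at least one vertex in `I`. -/
def facesMeeting (I : Set V) : Set F := {f | ∃ c, T.vert f c ∈ I}

open Classical in
/-- The length of the circle at the vertex `v` in the circle packing with curvatures `k`: the sum,
over all corners at `v`, of the arc of the circle at `v` in the three-circle configuration of
the face. -/
def circleLength [Fintype F] (k : V → ℝ) (v : V) : ℝ :=
  ∑ f : F, ∑ c : Fin 3,
    if T.vert f c = v then tangencyArcLength (fun j => k (T.vert f j)) c else 0

/-- The total geodesic curvature `L(v) = l(v) k(v)`. -/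
def totalGeodesicCurvature [Fintype F] (k : V → ℝ) (v : V) : ℝ :=
  T.circleLength k v * k v

/-- `k` solves `dkᵢ/dt = -kᵢ (Lᵢ - L̂ᵢ)` in `ℝ_{>0}^V` on the time interval `J`. -/
def IsFlowSolutionOn [Fintype F] (Lhat : V → ℝ) (J : Set ℝ) (k : ℝ → V → ℝ) : Prop :=
  ∀ t ∈ J, ∀ i, 0 < k t i ∧
    HasDerivWithinAt (fun s => k s i) (-(k t i * (T.totalGeodesicCurvature (k t) i - Lhat i))) J t

end TriangulatedSurface

/-- A generalized hyperbolic circle packing metric on `(S_{I₁,I₂}, T_{I₁,I₂})`: the vertices in `I₁`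
carry hypercycles, those in `I₂` horocycles, and the others circles. -/
structure IsGeneralizedCirclePackingMetric {V : Type*} (I₁ I₂ : Set V) (k : V → ℝ) : Prop where
  disjoint : Disjoint I₁ I₂
  pos : ∀ i, 0 < k i
  hypercycle : ∀ i ∈ I₁, k i < 1
  horocycle : ∀ i ∈ I₂, k i = 1
  circle : ∀ i, i ∉ I₁ → i ∉ I₂ → 1 < k i

/-- `k(t)` converges, in the space `ℝ_{>0}^V` of circle packing metrics, as `t → ∞`. -/
def FlowConverges {V : Type*} (k : ℝ → V → ℝ) : Prop :=
  ∃ k' : V → ℝ, (∀ i, 0 < k' i) ∧ Tendsto k atTop (𝓝 k')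

end

/-! In the upper half-plane, circles, horocycles and hypercycles of curvature `k` are all Euclidean
circles whose centre has height `k` times the radius. A half-angle substitution then gives one
formula for the total curvature of an arc in a tangent triple `x, a, b`, namely `(2x/√D) ∫₀¹ ds / (1
+ (x² - 1) s² / D)` with `D = 1 + xa + xb + ab` (`arcCurvature`, `tangencyArcLength_mul`). It is
continuously differentiable across `x = 1`, so the three types need no separate treatment.

The rest uses three properties of arcs. An arc loses curvature when a neighbour's `k` grows
(`arcCurvature_antitone`). It gains strictly when all three `k` are scaled up
(`strictMonoOn_arcCurvature_scale`). The sum of the three arcs increases in each variable and tends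
to `π` when one of them tends to infinity (by Gauss–Bonnet its defect from `π` is the area of the
interstice). Summation over the faces meeting `I` shows that the inequalities are necessary.

For sufficiency, Perron's method takes the supremum of the vectors `k ≥ ε` with `L(k) ≤ Lhat`. These
are closed under maxima, and the inequalities on the sets `I` bound them: if they were unbounded
exactly on `I`, each face of `F_I` would contribute almost `π`. Uniqueness is a maximum principle at
a vertex where `k / k'` is largest.

For `u = log k` the flow is `u' = Lhat - L(exp u)`, a bounded `C¹` field, hence solvable for all
time. Limits are zeros of the field. Conversely, near a zero `w` a uniform shift of `w` is a scaling
of curvatures, whose positive rate makes `w ± N e^{-δt}` barriers; this gives exponential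
convergence. -/

noncomputable section

/-! ### The integrals `∫₀¹ s^{2n} / (1 + y s²)^p ds` -/

/-- The integral `∫₀¹ s^{2n} / (1 + y s²)^p ds`. -/
def rationalMoment (n p : ℕ) (y : ℝ) : ℝ :=
  ∫ s in (0 : ℝ)..1, s ^ (2 * n) / (1 + y * s ^ 2) ^ p

lemma one_add_mul_sq_pos {y s : ℝ} (hy : -1 < y) (h0 : 0 ≤ s) (h1 : s ≤ 1) :
    0 < 1 + y * s ^ 2 := by
  have : s ^ 2 ≤ 1 := by nlinarith
  rcases le_total 0 y with h | h
  · positivity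
  · nlinarith

lemma continuousOn_rationalMoment_integrand (n p : ℕ) {y : ℝ} (hy : -1 < y) :
    ContinuousOn (fun s : ℝ => s ^ (2 * n) / (1 + y * s ^ 2) ^ p) (Set.uIcc 0 1) := by
  refine ContinuousOn.div (by fun_prop) (by fun_prop) fun s hs => ?_
  rw [Set.uIcc_of_le zero_le_one] at hs
  exact pow_ne_zero _ (one_add_mul_sq_pos hy hs.1 hs.2).ne'

lemma intervalIntegrable_rationalMoment_integrand (n p : ℕ) {y : ℝ} (hy : -1 < y) :
    IntervalIntegrable (fun s : ℝ => s ^ (2 * n) / (1 + y * s ^ 2) ^ p)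
      MeasureTheory.volume 0 1 :=
  (continuousOn_rationalMoment_integrand n p hy).intervalIntegrable

lemma hasDerivAt_rationalMoment (n p : ℕ) {y : ℝ} (hy : -1 < y) :
    HasDerivAt (rationalMoment n p) (-(p * rationalMoment (n + 1) (p + 1) y)) y := by
  -- `e - 1` is the midpoint of `-1` and `y`; to the right of it the denominators stay above `min e
  -- 1`.
  set e : ℝ := (1 + y) / 2 with he
  have hepos : 0 < e := by rw [he]; linarith
  have key := intervalIntegral.hasDerivAt_integral_of_dominated_loc_of_deriv_le
    (μ := MeasureTheory.volume) (a := 0) (b := 1) (x₀ := y) (s := Set.Ioi (e - 1))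
    (F := fun y s => s ^ (2 * n) / (1 + y * s ^ 2) ^ p)
    (F' := fun y s => -(p * (s ^ (2 * (n + 1)) / (1 + y * s ^ 2) ^ (p + 1))))
    (bound := fun _ => p / (min e 1) ^ (p + 1))
    (Ioi_mem_nhds (by rw [he]; linarith))
    (by
      filter_upwards [Ioi_mem_nhds hy] with z hz
      exact (intervalIntegrable_iff.1
        (intervalIntegrable_rationalMoment_integrand n p hz)).aestronglyMeasurable)
    (intervalIntegrable_rationalMoment_integrand n p hy)
    (intervalIntegrable_iff.1 ((intervalIntegrable_rationalMoment_integrand (n + 1) (p + 1)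
      hy).const_mul (p : ℝ)).neg).aestronglyMeasurable
    (by
      refine Filter.Eventually.of_forall fun s hs z hz => ?_
      rw [Set.uIoc_of_le zero_le_one] at hs
      have hz' : e - 1 < z := hz
      have hs2 : s ^ 2 ≤ 1 := by nlinarith [hs.1, hs.2]
      have hm : min e 1 ≤ 1 + z * s ^ 2 := by
        have h1 : (e - 1) * s ^ 2 ≤ z * s ^ 2 := by gcongr
        rcases le_total e 1 with h | h
        · rw [min_eq_left h]; nlinarith
        · rw [min_eq_right h]; nlinarith [sq_nonneg s]
      have hm0 : 0 < min e 1 := lt_min hepos one_pos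
      have hpos : 0 < 1 + z * s ^ 2 := hm0.trans_le hm
      rw [norm_neg, Real.norm_of_nonneg (by have := hs.1; positivity), div_eq_mul_one_div (p : ℝ)]
      have hs1 : s ^ (2 * (n + 1)) ≤ 1 := pow_le_one₀ hs.1.le hs.2
      gcongr)
    intervalIntegrable_const
    (by
      refine Filter.Eventually.of_forall fun s hs z hz => ?_
      rw [Set.uIoc_of_le zero_le_one] at hs
      have hz' : e - 1 < z := hz
      have hpos : 0 < 1 + z * s ^ 2 := one_add_mul_sq_pos (by linarith) hs.1.le hs.2
      have h1 : HasDerivAt (fun z : ℝ => 1 + z * s ^ 2) (s ^ 2) z := by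
        simpa using ((hasDerivAt_id z).mul_const (s ^ 2)).const_add 1
      have h2 := (((h1.pow p).inv (pow_pos hpos p).ne').const_mul (s ^ (2 * n)))
      simp only [← div_eq_mul_inv, Pi.pow_apply, Pi.inv_apply] at h2
      refine h2.congr_deriv ?_
      rcases p with _ | p
      · simp
      · field_simp
        simp
        ring)
  have := key.2
  rw [intervalIntegral.integral_neg, intervalIntegral.integral_const_mul] at this
  exact this

lemma continuousOn_rationalMoment (n p : ℕ) : ContinuousOn (rationalMoment n p) (Set.Ioi (-1)) :=
  fun _ hy => (hasDerivAt_rationalMoment n p hy).continuousAt.continuousWithinAt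

lemma rationalMoment_pos (n p : ℕ) {y : ℝ} (hy : -1 < y) : 0 < rationalMoment n p y := by
  refine intervalIntegral.intervalIntegral_pos_of_pos_on
    (intervalIntegrable_rationalMoment_integrand n p hy) (fun s hs => ?_) zero_lt_one
  have := one_add_mul_sq_pos hy hs.1.le hs.2.le
  have := hs.1
  positivity

/-- Integrate the derivative of `s / (1 + y s²)` over `[0, 1]`. -/
lemma rationalMoment_sub_two_mul {y : ℝ} (hy : -1 < y) :
    rationalMoment 0 1 y - 2 * y * rationalMoment 1 2 y = 1 / (1 + y) := by
  have h : ∀ s ∈ Set.uIcc (0 : ℝ) 1, HasDerivAt (fun s : ℝ => s / (1 + y * s ^ 2))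
      (s ^ (2 * 0) / (1 + y * s ^ 2) ^ 1 - 2 * y * (s ^ (2 * 1) / (1 + y * s ^ 2) ^ 2)) s := by
    intro s hs
    rw [Set.uIcc_of_le zero_le_one] at hs
    have hpos := one_add_mul_sq_pos hy hs.1 hs.2
    have h1 : HasDerivAt (fun s : ℝ => 1 + y * s ^ 2) (y * (2 * s)) s := by
      simpa using ((hasDerivAt_pow 2 s).const_mul y).const_add 1
    refine ((hasDerivAt_id s).div h1 hpos.ne').congr_deriv ?_
    simp only [id]
    field_simp
    ring
  have i1 := intervalIntegrable_rationalMoment_integrand 0 1 hy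
  have i2 := (intervalIntegrable_rationalMoment_integrand 1 2 hy).const_mul (2 * y)
  have := intervalIntegral.integral_eq_sub_of_hasDerivAt h (i1.sub i2)
  rw [intervalIntegral.integral_sub i1 i2, intervalIntegral.integral_const_mul] at this
  simpa [rationalMoment] using this

/-- Integrate the derivative of `s³ / (1 + y s²)`. Derivatives of arcs can thus be written with the
positive moment `rationalMoment 1 1` alone. -/
lemma inv_sub_two_mul_rationalMoment {y : ℝ} (hy : -1 < y) :
    1 / (1 + y) - 2 * rationalMoment 1 2 y = rationalMoment 1 1 y := by
  have h : ∀ s ∈ Set.uIcc (0 : ℝ) 1, HasDerivAt (fun s : ℝ => s ^ 3 / (1 + y * s ^ 2))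
      (s ^ (2 * 1) / (1 + y * s ^ 2) ^ 1 + 2 * (s ^ (2 * 1) / (1 + y * s ^ 2) ^ 2)) s := by
    intro s hs
    rw [Set.uIcc_of_le zero_le_one] at hs
    have hpos := one_add_mul_sq_pos hy hs.1 hs.2
    have h1 : HasDerivAt (fun s : ℝ => 1 + y * s ^ 2) (y * (2 * s)) s := by
      simpa using ((hasDerivAt_pow 2 s).const_mul y).const_add 1
    refine ((hasDerivAt_pow 3 s).div h1 hpos.ne').congr_deriv ?_
    field_simp
    norm_num
    ring
  have i1 := intervalIntegrable_rationalMoment_integrand 1 1 hy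
  have i2 := (intervalIntegrable_rationalMoment_integrand 1 2 hy).const_mul 2
  have := intervalIntegral.integral_eq_sub_of_hasDerivAt h (i1.add i2)
  rw [intervalIntegral.integral_add i1 i2, intervalIntegral.integral_const_mul] at this
  norm_num at this
  simp only [rationalMoment]
  norm_num
  linarith

lemma contDiffOn_rationalMoment (n p : ℕ) :
    ContDiffOn ℝ 1 (rationalMoment n p) (Set.Ioi (-1)) := by
  rw [contDiffOn_one_iff_derivWithin isOpen_Ioi.uniqueDiffOn]
  refine ⟨fun y hy => (hasDerivAt_rationalMoment n p hy).differentiableAt.differentiableWithinAt,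
    ContinuousOn.congr ((continuousOn_rationalMoment (n + 1) (p + 1)).const_mul (p : ℝ)).neg ?_⟩
  intro y hy
  rw [derivWithin_of_isOpen isOpen_Ioi hy, (hasDerivAt_rationalMoment n p hy).deriv]
  rfl

lemma rationalMoment_zero_one_of_pos {y : ℝ} (hy : 0 < y) :
    rationalMoment 0 1 y = Real.arctan (√y) / √y := by
  have hs : 0 < √y := Real.sqrt_pos.2 hy
  have h : ∀ s ∈ Set.uIcc (0 : ℝ) 1, HasDerivAt (fun s : ℝ => Real.arctan (√y * s) / √y)
      (s ^ (2 * 0) / (1 + y * s ^ 2) ^ 1) s := by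
    intro s _
    have h1 : HasDerivAt (fun s : ℝ => √y * s) (√y) s := by
      simpa using (hasDerivAt_id s).const_mul (√y)
    refine ((h1.arctan).div_const (√y)).congr_deriv ?_
    rw [mul_pow, Real.sq_sqrt hy.le]
    field_simp
    simp
  have := intervalIntegral.integral_eq_sub_of_hasDerivAt h
    (intervalIntegrable_rationalMoment_integrand 0 1 (by linarith))
  simpa [rationalMoment] using this

/-- Since `s² ≤ s`, the integrand is at most `1 / (1 - (1 - t) s)`, with integral `-log t / (1 -
t)`; the bound `t ≤ 1/2` gives the factor `2`. -/
lemma rationalMoment_zero_one_le_log {t : ℝ} (h0 : 0 < t) (h1 : t ≤ 1 / 2) :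
    rationalMoment 0 1 (t - 1) ≤ -(2 * Real.log t) := by
  have hpos : ∀ s ∈ Set.Icc (0 : ℝ) 1, 0 < 1 - (1 - t) * s := fun s hs => by
    nlinarith [hs.1, hs.2]
  have h : ∀ s ∈ Set.uIcc (0 : ℝ) 1, HasDerivAt
      (fun s : ℝ => -(Real.log (1 - (1 - t) * s) / (1 - t))) (1 / (1 - (1 - t) * s)) s := by
    intro s hs
    rw [Set.uIcc_of_le zero_le_one] at hs
    have h1' : HasDerivAt (fun s : ℝ => 1 - (1 - t) * s) (-(1 - t)) s := by
      simpa using ((hasDerivAt_id s).const_mul (1 - t)).const_sub 1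
    refine (((h1'.log (hpos s hs).ne').div_const (1 - t)).neg).congr_deriv ?_
    have : (1 - t) ≠ 0 := by linarith
    field_simp
  have hc : ContinuousOn (fun s : ℝ => 1 / (1 - (1 - t) * s)) (Set.uIcc 0 1) := by
    refine ContinuousOn.div (by fun_prop) (by fun_prop) fun s hs => ?_
    rw [Set.uIcc_of_le zero_le_one] at hs
    exact (hpos s hs).ne'
  have hI := intervalIntegral.integral_eq_sub_of_hasDerivAt h hc.intervalIntegrable
  have hle : rationalMoment 0 1 (t - 1) ≤ ∫ s in (0 : ℝ)..1, 1 / (1 - (1 - t) * s) := by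
    refine intervalIntegral.integral_mono_on zero_le_one
      (intervalIntegrable_rationalMoment_integrand 0 1 (by linarith)) hc.intervalIntegrable
      fun s hs => ?_
    have := hpos s hs
    simp only [mul_zero, pow_zero, pow_one]
    refine one_div_le_one_div_of_le this ?_
    nlinarith [mul_nonneg hs.1 (sub_nonneg.2 hs.2)]
  rw [hI] at hle
  refine hle.trans ?_
  have hlog : Real.log t ≤ 0 := Real.log_nonpos h0.le (by linarith)
  simp only [mul_one, mul_zero, sub_zero, Real.log_one, zero_div, neg_zero, sub_sub_cancel]
  rw [neg_le_neg_iff, le_div_iff₀ (by linarith)]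
  nlinarith

/-! ### The total geodesic curvature of an arc of a three-circle configuration -/

/-- `2 X / √D ∫₀¹ ds / (1 + (X² - 1) s² / D)`, the total geodesic curvature of an arc of geodesic
curvature `X` in a three-circle configuration whose incircle has geodesic curvature `√D`. -/
def incircleArcCurvature (X D : ℝ) : ℝ :=
  2 * X / √D * rationalMoment 0 1 ((X ^ 2 - 1) / D)

/-- The squared geodesic curvature of the circle through the points of tangency of three mutually
tangent circles of geodesic curvatures `x`, `a`, `b`. -/
def incircleCurvatureSq (x a b : ℝ) : ℝ := 1 + x * a + x * b + a * b

/-- The total geodesic curvature of the arc of the circle of geodesic curvature `x` in a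
configuration of three mutually tangent circles of geodesic curvatures `x`, `a`, `b`. -/
def arcCurvature (x a b : ℝ) : ℝ := incircleArcCurvature x (incircleCurvatureSq x a b)

lemma neg_one_lt_div_of_pos {X D : ℝ} (hD : 0 < D) (h : 0 < D + X ^ 2 - 1) :
    -1 < (X ^ 2 - 1) / D := by
  rw [lt_div_iff₀ hD]; linarith

/-- A single chain rule for neighbour, self and scaling derivatives. The two moment identities leave
one positive integral and rational terms, whose denominator `D + X² - 1` factors as `(x + a)(x + b)`
for a tangent triple. -/
lemma hasDerivAt_incircleArcCurvature {X D : ℝ → ℝ} {X' D' t : ℝ} (hX : HasDerivAt X X' t)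
    (hD : HasDerivAt D D' t) (hpos : 0 < D t) (h : 0 < D t + X t ^ 2 - 1) :
    HasDerivAt (fun t => incircleArcCurvature (X t) (D t))
      (X' * (2 * rationalMoment 1 1 ((X t ^ 2 - 1) / D t) / √(D t) ^ 3
        + 2 * (D t - 1) / (√(D t) * (D t + X t ^ 2 - 1)))
        - D' * (X t / (√(D t) * (D t + X t ^ 2 - 1)))) t := by
  have hy := neg_one_lt_div_of_pos hpos h
  have hq : 0 < √(D t) := Real.sqrt_pos.2 hpos
  have hY : HasDerivAt (fun t => (X t ^ 2 - 1) / D t) _ t :=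
    ((hX.pow 2).sub_const 1).div hD hpos.ne'
  have hh := (hasDerivAt_rationalMoment 0 1 hy).comp t hY
  have key := ((hX.const_mul 2).div (hD.sqrt hpos.ne') hq.ne').mul hh
  refine key.congr_deriv ?_
  have e1 := rationalMoment_sub_two_mul hy
  have e2 := inv_sub_two_mul_rationalMoment hy
  have hsq : √(D t) ^ 2 = D t := Real.sq_sqrt hpos.le
  set h0 := rationalMoment 0 1 ((X t ^ 2 - 1) / D t) with hh0
  set h1 := rationalMoment 1 2 ((X t ^ 2 - 1) / D t) with hh1
  set m := rationalMoment 1 1 ((X t ^ 2 - 1) / D t) with hm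
  set q := √(D t)
  have e3 : 1 / (1 + (X t ^ 2 - 1) / D t) = D t / (D t + X t ^ 2 - 1) := by
    have : 1 + (X t ^ 2 - 1) / D t = (D t + X t ^ 2 - 1) / D t := by field_simp; ring
    rw [this, one_div_div]
  rw [e3] at e1 e2
  have e1' : h0 = D t / (D t + X t ^ 2 - 1) + 2 * ((X t ^ 2 - 1) / D t) * h1 := by linarith
  simp only [Function.comp_apply, Nat.cast_one, one_mul, Pi.pow_apply, Pi.div_apply]
  rw [← hh0, show √(D t) = q from rfl, e1', ← e2, ← hsq]
  rw [← hsq] at h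
  have h' := h.ne'
  generalize X t = x at *
  clear_value q h1
  clear e1 e2 e3 e1' hh hY hh0 hh1 hm hy hsq key
  field_simp
  ring

lemma incircleCurvatureSq_pos {x a b : ℝ} (hx : 0 < x) (ha : 0 < a) (hb : 0 < b) :
    0 < incircleCurvatureSq x a b := by
  unfold incircleCurvatureSq; positivity

lemma incircleCurvatureSq_add (x a b : ℝ) :
    incircleCurvatureSq x a b + x ^ 2 - 1 = (x + a) * (x + b) := by
  unfold incircleCurvatureSq; ring

lemma incircleCurvatureSq_add_pos {x a b : ℝ} (hx : 0 < x) (ha : 0 < a) (hb : 0 < b) :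
    0 < incircleCurvatureSq x a b + x ^ 2 - 1 := by
  rw [incircleCurvatureSq_add]; positivity

lemma incircleCurvatureSq_ratio {x a b : ℝ} (hx : 0 < x) (ha : 0 < a) (hb : 0 < b) :
    -1 < (x ^ 2 - 1) / incircleCurvatureSq x a b :=
  neg_one_lt_div_of_pos (incircleCurvatureSq_pos hx ha hb) (incircleCurvatureSq_add_pos hx ha hb)

lemma arcCurvature_comm (x a b : ℝ) : arcCurvature x a b = arcCurvature x b a := by
  unfold arcCurvature incircleCurvatureSq; ring_nf

lemma arcCurvature_pos {x a b : ℝ} (hx : 0 < x) (ha : 0 < a) (hb : 0 < b) :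
    0 < arcCurvature x a b := by
  have := Real.sqrt_pos.2 (incircleCurvatureSq_pos hx ha hb)
  have := rationalMoment_pos 0 1 (incircleCurvatureSq_ratio hx ha hb)
  unfold arcCurvature incircleArcCurvature
  positivity

lemma hasDerivAt_arcCurvature_neighbour {x a b : ℝ} (hx : 0 < x) (ha : 0 < a) (hb : 0 < b) :
    HasDerivAt (fun a => arcCurvature x a b)
      (-(x / (√(incircleCurvatureSq x a b) * (x + a)))) a := by
  have hD : HasDerivAt (fun a => incircleCurvatureSq x a b) (x + b) a := by
    have : HasDerivAt (fun a => (x + b) * a + (1 + x * b)) (x + b) a := by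
      simpa using ((hasDerivAt_id a).const_mul (x + b)).add_const (1 + x * b)
    refine this.congr_of_eventuallyEq (Eventually.of_forall fun a => ?_)
    simp only [incircleCurvatureSq]; ring
  have hpos := incircleCurvatureSq_pos hx ha hb
  refine (hasDerivAt_incircleArcCurvature (hasDerivAt_const a x) hD hpos
    (incircleCurvatureSq_add_pos hx ha hb)).congr_deriv ?_
  rw [incircleCurvatureSq_add]
  have := Real.sqrt_pos.2 hpos
  field_simp
  ring

/-- The part of the derivatives of `arcCurvature` that measures the area of the interstice. -/
def interstitialDeriv (x a b : ℝ) : ℝ :=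
  2 * rationalMoment 1 1 ((x ^ 2 - 1) / incircleCurvatureSq x a b)
    / √(incircleCurvatureSq x a b) ^ 3

lemma interstitialDeriv_pos {x a b : ℝ} (hx : 0 < x) (ha : 0 < a) (hb : 0 < b) :
    0 < interstitialDeriv x a b := by
  have := Real.sqrt_pos.2 (incircleCurvatureSq_pos hx ha hb)
  have := rationalMoment_pos 1 1 (incircleCurvatureSq_ratio hx ha hb)
  unfold interstitialDeriv
  positivity

lemma hasDerivAt_arcCurvature_self {x a b : ℝ} (hx : 0 < x) (ha : 0 < a) (hb : 0 < b) :
    HasDerivAt (fun x => arcCurvature x a b)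
      (interstitialDeriv x a b + a / (√(incircleCurvatureSq x a b) * (x + a))
        + b / (√(incircleCurvatureSq x a b) * (x + b))) x := by
  have hD : HasDerivAt (fun x => incircleCurvatureSq x a b) (a + b) x := by
    have : HasDerivAt (fun x => (a + b) * x + (1 + a * b)) (a + b) x := by
      simpa using ((hasDerivAt_id x).const_mul (a + b)).add_const (1 + a * b)
    refine this.congr_of_eventuallyEq (Eventually.of_forall fun a => ?_)
    simp only [incircleCurvatureSq]; ring
  have hpos := incircleCurvatureSq_pos hx ha hb
  refine (hasDerivAt_incircleArcCurvature (hasDerivAt_id x) hD hpos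
    (incircleCurvatureSq_add_pos hx ha hb)).congr_deriv ?_
  simp only [id, incircleCurvatureSq_add, interstitialDeriv]
  have hq := Real.sqrt_pos.2 hpos
  generalize √(incircleCurvatureSq x a b) = q at *
  simp only [incircleCurvatureSq]
  have := hq.ne'
  field_simp
  ring

/-- `D - 1` is homogeneous of degree two, so the rational terms cancel and only the positive
integral remains. -/
lemma hasDerivAt_arcCurvature_scale {x a b t : ℝ} (hx : 0 < x) (ha : 0 < a) (hb : 0 < b)
    (ht : 0 < t) :
    HasDerivAt (fun t => arcCurvature (t * x) (t * a) (t * b))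
      (x * interstitialDeriv (t * x) (t * a) (t * b)) t := by
  have hD : HasDerivAt (fun t => incircleCurvatureSq (t * x) (t * a) (t * b))
      ((x * a + x * b + a * b) * (2 * t)) t := by
    have : HasDerivAt (fun t : ℝ => (x * a + x * b + a * b) * t ^ 2 + 1)
        ((x * a + x * b + a * b) * (2 * t)) t := by
      simpa using ((hasDerivAt_pow 2 t).const_mul (x * a + x * b + a * b)).add_const 1
    refine this.congr_of_eventuallyEq (Eventually.of_forall fun a => ?_)
    simp only [incircleCurvatureSq]; ring
  have hX : HasDerivAt (fun t => t * x) x t := by simpa using (hasDerivAt_id t).mul_const x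
  have hx' := mul_pos ht hx
  have ha' := mul_pos ht ha
  have hb' := mul_pos ht hb
  have hpos := incircleCurvatureSq_pos hx' ha' hb'
  refine (hasDerivAt_incircleArcCurvature hX hD hpos
    (incircleCurvatureSq_add_pos hx' ha' hb')).congr_deriv ?_
  simp only [incircleCurvatureSq_add, interstitialDeriv]
  have hq := Real.sqrt_pos.2 hpos
  generalize √(incircleCurvatureSq (t * x) (t * a) (t * b)) = q at *
  simp only [incircleCurvatureSq]
  have := hq.ne'
  field_simp
  ring

lemma contDiffAt_arcCurvature {p : ℝ × ℝ × ℝ} (hx : 0 < p.1) (ha : 0 < p.2.1) (hb : 0 < p.2.2) :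
    ContDiffAt ℝ 1 (fun p : ℝ × ℝ × ℝ => arcCurvature p.1 p.2.1 p.2.2) p := by
  have hpos := incircleCurvatureSq_pos hx ha hb
  have hD : ContDiffAt ℝ 1 (fun p : ℝ × ℝ × ℝ => incircleCurvatureSq p.1 p.2.1 p.2.2) p := by
    unfold incircleCurvatureSq
    fun_prop
  have hh : ContDiffAt ℝ 1 (rationalMoment 0 1)
      ((p.1 ^ 2 - 1) / incircleCurvatureSq p.1 p.2.1 p.2.2) :=
    (contDiffOn_rationalMoment 0 1).contDiffAt
      (Ioi_mem_nhds (incircleCurvatureSq_ratio hx ha hb))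
  have hy : ContDiffAt ℝ 1
      (fun p : ℝ × ℝ × ℝ => (p.1 ^ 2 - 1) / incircleCurvatureSq p.1 p.2.1 p.2.2) p :=
    ContDiffAt.div (by fun_prop) hD hpos.ne'
  unfold arcCurvature incircleArcCurvature
  refine ContDiffAt.mul (ContDiffAt.div (by fun_prop) (hD.sqrt hpos.ne')
    (Real.sqrt_pos.2 hpos).ne') (ContDiffAt.comp (f := fun p : ℝ × ℝ × ℝ =>
      (p.1 ^ 2 - 1) / incircleCurvatureSq p.1 p.2.1 p.2.2) p hh hy)

lemma continuousAt_interstitialDeriv {p : ℝ × ℝ × ℝ} (hx : 0 < p.1) (ha : 0 < p.2.1)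
    (hb : 0 < p.2.2) :
    ContinuousAt (fun p : ℝ × ℝ × ℝ => interstitialDeriv p.1 p.2.1 p.2.2) p := by
  have hpos := incircleCurvatureSq_pos hx ha hb
  have hD : ContinuousAt (fun p : ℝ × ℝ × ℝ => incircleCurvatureSq p.1 p.2.1 p.2.2) p := by
    unfold incircleCurvatureSq
    fun_prop
  have hh : ContinuousAt (rationalMoment 1 1)
      ((p.1 ^ 2 - 1) / incircleCurvatureSq p.1 p.2.1 p.2.2) :=
    (continuousOn_rationalMoment 1 1).continuousAt
      (Ioi_mem_nhds (incircleCurvatureSq_ratio hx ha hb))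
  have hy : ContinuousAt
      (fun p : ℝ × ℝ × ℝ => (p.1 ^ 2 - 1) / incircleCurvatureSq p.1 p.2.1 p.2.2) p :=
    ContinuousAt.div (by fun_prop) hD hpos.ne'
  unfold interstitialDeriv
  refine ContinuousAt.div (continuousAt_const.mul (ContinuousAt.comp (f := fun p : ℝ × ℝ × ℝ =>
    (p.1 ^ 2 - 1) / incircleCurvatureSq p.1 p.2.1 p.2.2) hh hy)) (hD.sqrt.pow 3)
    (pow_ne_zero _ (Real.sqrt_pos.2 hpos).ne')

/-! ### Monotonicity -/

lemma arcCurvature_antitone_left {x a a' b : ℝ} (hx : 0 < x) (ha : 0 < a) (hb : 0 < b)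
    (h : a ≤ a') : arcCurvature x a' b ≤ arcCurvature x a b := by
  refine antitoneOn_of_hasDerivWithinAt_nonpos (D := Set.Ioi 0) (convex_Ioi 0)
    (f := fun a => arcCurvature x a b)
    (f' := fun a => -(x / (√(incircleCurvatureSq x a b) * (x + a)))) ?_ ?_ ?_ ha
    (ha.trans_le h) h
  · exact fun a ha => (hasDerivAt_arcCurvature_neighbour hx ha hb).continuousAt.continuousWithinAt
  · intro a ha
    rw [interior_Ioi] at ha
    exact (hasDerivAt_arcCurvature_neighbour hx ha hb).hasDerivWithinAt
  · intro a ha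
    rw [interior_Ioi] at ha
    have : 0 < a := ha
    rw [neg_nonpos]
    positivity

lemma arcCurvature_antitone {x a a' b b' : ℝ} (hx : 0 < x) (ha : 0 < a) (hb : 0 < b)
    (h : a ≤ a') (h' : b ≤ b') : arcCurvature x a' b' ≤ arcCurvature x a b := by
  refine (arcCurvature_antitone_left hx ha (hb.trans_le h') h).trans ?_
  rw [arcCurvature_comm x a, arcCurvature_comm x a]
  exact arcCurvature_antitone_left hx hb ha h'

lemma strictMonoOn_arcCurvature_scale {x a b : ℝ} (hx : 0 < x) (ha : 0 < a) (hb : 0 < b) :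
    StrictMonoOn (fun t => arcCurvature (t * x) (t * a) (t * b)) (Set.Ioi 0) := by
  refine strictMonoOn_of_hasDerivWithinAt_pos (convex_Ioi 0)
    (f' := fun t => x * interstitialDeriv (t * x) (t * a) (t * b)) ?_ ?_ ?_
  · exact fun t ht =>
      (hasDerivAt_arcCurvature_scale hx ha hb ht).continuousAt.continuousWithinAt
  · intro t ht
    rw [interior_Ioi] at ht
    exact (hasDerivAt_arcCurvature_scale hx ha hb ht).hasDerivWithinAt
  · intro t ht
    rw [interior_Ioi] at ht
    exact mul_pos hx (interstitialDeriv_pos (mul_pos ht hx) (mul_pos ht ha) (mul_pos ht hb))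

/-- Scale the triple by `x' / x`, then lower the two neighbours back to `a` and `b`: both moves
increase the arc. -/
lemma arcCurvature_mono_self {x x' a b : ℝ} (hx : 0 < x) (ha : 0 < a) (hb : 0 < b)
    (h : x ≤ x') : arcCurvature x a b ≤ arcCurvature x' a b := by
  have ht : 1 ≤ x' / x := (one_le_div hx).2 h
  have h1 := (strictMonoOn_arcCurvature_scale hx ha hb).monotoneOn (a := 1) (b := x' / x)
    (Set.mem_Ioi.2 one_pos) (Set.mem_Ioi.2 (one_pos.trans_le ht)) ht
  simp only [one_mul, div_mul_cancel₀ x' hx.ne'] at h1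
  exact h1.trans (arcCurvature_antitone (hx.trans_le h) ha hb (le_mul_of_one_le_left ha.le ht)
    (le_mul_of_one_le_left hb.le ht))

/-- The total geodesic curvature of the boundary of the interstice of three mutually tangent
circles. -/
def interstitialCurvature (x a b : ℝ) : ℝ :=
  arcCurvature x a b + arcCurvature a b x + arcCurvature b x a

lemma interstitialCurvature_rotate (x a b : ℝ) :
    interstitialCurvature x a b = interstitialCurvature a b x := by
  unfold interstitialCurvature; ring

/-- The rational terms of the self derivative cancel against the derivatives of the two other arcs.
-/
lemma hasDerivAt_interstitialCurvature {x a b : ℝ} (hx : 0 < x) (ha : 0 < a) (hb : 0 < b) :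
    HasDerivAt (fun x => interstitialCurvature x a b) (interstitialDeriv x a b) x := by
  have h2 : HasDerivAt (fun x => arcCurvature a b x) _ x :=
    (hasDerivAt_arcCurvature_neighbour ha hx hb).congr_of_eventuallyEq
      (Eventually.of_forall fun x => arcCurvature_comm a b x)
  refine (((hasDerivAt_arcCurvature_self hx ha hb).add h2).add
    (hasDerivAt_arcCurvature_neighbour hb hx ha)).congr_deriv ?_
  have e1 : incircleCurvatureSq a x b = incircleCurvatureSq x a b := by
    unfold incircleCurvatureSq; ring
  have e2 : incircleCurvatureSq b x a = incircleCurvatureSq x a b := by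
    unfold incircleCurvatureSq; ring
  rw [e1, e2, add_comm a x, add_comm b x]
  ring

lemma strictMonoOn_interstitialCurvature {a b : ℝ} (ha : 0 < a) (hb : 0 < b) :
    StrictMonoOn (fun x => interstitialCurvature x a b) (Set.Ioi 0) := by
  refine strictMonoOn_of_hasDerivWithinAt_pos (convex_Ioi 0)
    (f' := fun x => interstitialDeriv x a b) ?_ ?_ ?_
  · exact fun x hx =>
      (hasDerivAt_interstitialCurvature hx ha hb).continuousAt.continuousWithinAt
  · intro x hx
    rw [interior_Ioi] at hx
    exact (hasDerivAt_interstitialCurvature hx ha hb).hasDerivWithinAt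
  · intro x hx
    rw [interior_Ioi] at hx
    exact interstitialDeriv_pos hx ha hb

lemma interstitialCurvature_mono {x x' a a' b b' : ℝ} (hx : 0 < x) (ha : 0 < a) (hb : 0 < b)
    (hxx : x ≤ x') (haa : a ≤ a') (hbb : b ≤ b') :
    interstitialCurvature x a b ≤ interstitialCurvature x' a' b' := by
  have hx' := hx.trans_le hxx
  have ha' := ha.trans_le haa
  have hb' := hb.trans_le hbb
  refine ((strictMonoOn_interstitialCurvature ha hb).monotoneOn hx hx' hxx).trans ?_
  rw [interstitialCurvature_rotate x', interstitialCurvature_rotate x']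
  refine ((strictMonoOn_interstitialCurvature hb hx').monotoneOn ha ha' haa).trans ?_
  rw [interstitialCurvature_rotate a', interstitialCurvature_rotate a']
  exact (strictMonoOn_interstitialCurvature hx' ha').monotoneOn hb hb' hbb

/-! ### Limits -/

lemma tendsto_incircleCurvatureSq_atTop {a b : ℝ} (ha : 0 < a) (hb : 0 < b) :
    Tendsto (fun x => incircleCurvatureSq x a b) atTop atTop := by
  have : Tendsto (fun x : ℝ => (1 + a * b) + (a + b) * x) atTop atTop :=
    tendsto_atTop_add_const_left _ _ (tendsto_id.const_mul_atTop (add_pos ha hb))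
  refine this.congr fun x => ?_
  unfold incircleCurvatureSq; ring

lemma tendsto_arcCurvature_self_atTop {a b : ℝ} (ha : 0 < a) (hb : 0 < b) :
    Tendsto (fun x => arcCurvature x a b) atTop (𝓝 Real.pi) := by
  have hy : Tendsto (fun x => (x ^ 2 - 1) / incircleCurvatureSq x a b) atTop atTop := by
    -- For `x ≥ 2` the denominator is at most `(1 + a + b + ab) x` and the numerator at least `x² /
    -- 2`.
    refine tendsto_atTop_mono' atTop (f₁ := fun x => (1 / (2 * (1 + a + b + a * b))) * x) ?_
      (tendsto_id.const_mul_atTop (by positivity))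
    filter_upwards [eventually_ge_atTop 2] with x hx
    have hD : incircleCurvatureSq x a b ≤ (1 + a + b + a * b) * x := by
      unfold incircleCurvatureSq
      nlinarith [mul_pos ha hb]
    have hpos := incircleCurvatureSq_pos (by linarith : 0 < x) ha hb
    rw [le_div_iff₀ hpos]
    calc 1 / (2 * (1 + a + b + a * b)) * x * incircleCurvatureSq x a b
        ≤ 1 / (2 * (1 + a + b + a * b)) * x * ((1 + a + b + a * b) * x) := by gcongr
      _ = x ^ 2 / 2 := by field_simp
      _ ≤ x ^ 2 - 1 := by nlinarith
  have h1 : Tendsto (fun x => Real.arctan (√((x ^ 2 - 1) / incircleCurvatureSq x a b))) atTop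
      (𝓝 (Real.pi / 2)) :=
    (Real.tendsto_arctan_atTop.mono_right nhdsWithin_le_nhds).comp
      (Real.tendsto_sqrt_atTop.comp hy)
  -- For `x > 1` the factor `√D` cancels, and the arc equals `2x / √(x² - 1)` times the arctangent
  -- in `h1`.
  have h2 : Tendsto (fun x : ℝ => 2 / √(1 - (x⁻¹) ^ 2)) atTop (𝓝 2) := by
    have : Tendsto (fun x : ℝ => 2 / √(1 - (x⁻¹) ^ 2)) atTop (𝓝 (2 / √(1 - 0 ^ 2))) :=
      tendsto_const_nhds.div ((tendsto_const_nhds.sub (tendsto_inv_atTop_zero.pow 2)).sqrt)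
        (by norm_num)
    simpa using this
  have h3 := h2.mul h1
  rw [mul_div_cancel₀ _ (two_ne_zero' ℝ)] at h3
  refine h3.congr' ?_
  filter_upwards [eventually_gt_atTop 1] with x hx
  have hx0 : 0 < x := by linarith
  have hpos := incircleCurvatureSq_pos hx0 ha hb
  have hx1 : 0 < x ^ 2 - 1 := by nlinarith
  have e : (1 - (x⁻¹) ^ 2) = (x ^ 2 - 1) / x ^ 2 := by field_simp
  unfold arcCurvature incircleArcCurvature
  rw [rationalMoment_zero_one_of_pos (by positivity), e, Real.sqrt_div hx1.le,
    Real.sqrt_sq hx0.le, Real.sqrt_div hx1.le]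
  have := Real.sqrt_pos.2 hx1
  have := Real.sqrt_pos.2 hpos
  field_simp

lemma tendsto_arcCurvature_neighbour_atTop {a b : ℝ} (ha : 0 < a) (hb : 0 < b) :
    Tendsto (fun x => arcCurvature a x b) atTop (𝓝 0) := by
  have hD : Tendsto (fun x => incircleCurvatureSq a x b) atTop atTop := by
    refine (tendsto_incircleCurvatureSq_atTop ha hb).congr fun x => ?_
    unfold incircleCurvatureSq; ring
  have hy : Tendsto (fun x => (a ^ 2 - 1) / incircleCurvatureSq a x b) atTop (𝓝 0) :=
    tendsto_const_nhds.div_atTop hD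
  have hh : Tendsto (fun x => rationalMoment 0 1 ((a ^ 2 - 1) / incircleCurvatureSq a x b)) atTop
      (𝓝 (rationalMoment 0 1 0)) :=
    ((continuousOn_rationalMoment 0 1).continuousAt (Ioi_mem_nhds (by norm_num))).tendsto.comp hy
  have h1 : Tendsto (fun x => 2 * a / √(incircleCurvatureSq a x b)) atTop (𝓝 0) :=
    tendsto_const_nhds.div_atTop (Real.tendsto_sqrt_atTop.comp hD)
  simpa [arcCurvature, incircleArcCurvature] using h1.mul hh

lemma tendsto_interstitialCurvature_atTop {a b : ℝ} (ha : 0 < a) (hb : 0 < b) :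
    Tendsto (fun x => interstitialCurvature x a b) atTop (𝓝 Real.pi) := by
  have h2 : Tendsto (fun x => arcCurvature a b x) atTop (𝓝 0) :=
    (tendsto_arcCurvature_neighbour_atTop ha hb).congr fun x => arcCurvature_comm a x b
  simpa [interstitialCurvature] using ((tendsto_arcCurvature_self_atTop ha hb).add h2).add
    (tendsto_arcCurvature_neighbour_atTop hb ha)

/-- An increasing function stays below its limit; the detour through `x + 1` makes this strict. -/
lemma interstitialCurvature_lt_pi {x a b : ℝ} (hx : 0 < x) (ha : 0 < a) (hb : 0 < b) :
    interstitialCurvature x a b < Real.pi := by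
  have hlt := strictMonoOn_interstitialCurvature ha hb hx (Set.mem_Ioi.2 (hx.trans (lt_add_one x)))
    (lt_add_one x)
  refine hlt.trans_le (ge_of_tendsto (tendsto_interstitialCurvature_atTop ha hb) ?_)
  filter_upwards [eventually_ge_atTop (x + 1)] with z hz
  exact (strictMonoOn_interstitialCurvature ha hb).monotoneOn
    (Set.mem_Ioi.2 (hx.trans (lt_add_one x))) (Set.mem_Ioi.2 (by linarith)) hz

lemma arcCurvature_lt_pi {x a b : ℝ} (hx : 0 < x) (ha : 0 < a) (hb : 0 < b) :
    arcCurvature x a b < Real.pi := by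
  have h := interstitialCurvature_lt_pi hx ha hb
  have h1 := arcCurvature_pos ha hb hx
  have h2 := arcCurvature_pos hb hx ha
  unfold interstitialCurvature at h
  linarith

/-- The argument of the moment tends to `-1`, but the moment is at most `-4 log x`, and `x log x →
0`. This supplies the small constant subsolution for Perron's method. -/
lemma tendsto_arcCurvature_diag_zero :
    Tendsto (fun x => arcCurvature x x x) (𝓝[>] 0) (𝓝 0) := by
  have hlog : Tendsto (fun x : ℝ => -8 * (Real.log x * x ^ (1 : ℝ))) (𝓝[>] 0) (𝓝 0) := by
    simpa using (tendsto_log_mul_rpow_nhdsGT_zero one_pos).const_mul (-8 : ℝ)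
  refine squeeze_zero' ?_ ?_ hlog
  · filter_upwards [self_mem_nhdsWithin] with x hx
    exact (arcCurvature_pos hx hx hx).le
  · filter_upwards [Ioo_mem_nhdsGT (by norm_num : (0 : ℝ) < 1 / 4)] with x hx
    have hx0 := hx.1
    have hx1 := hx.2
    have hD : incircleCurvatureSq x x x = 1 + 3 * x ^ 2 := by unfold incircleCurvatureSq; ring
    have hq : 1 ≤ √(1 + 3 * x ^ 2) := by
      rw [Real.one_le_sqrt]; nlinarith
    have e : (x ^ 2 - 1) / (1 + 3 * x ^ 2) = 4 * x ^ 2 / (1 + 3 * x ^ 2) - 1 := by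
      field_simp; ring
    have ht : x ^ 2 ≤ 4 * x ^ 2 / (1 + 3 * x ^ 2) := by
      rw [le_div_iff₀ (by positivity)]
      have : x ^ 2 ≤ 1 := by nlinarith
      nlinarith [mul_nonneg (sq_nonneg x) (sub_nonneg.2 this)]
    have hl : -(2 * Real.log (4 * x ^ 2 / (1 + 3 * x ^ 2))) ≤ -(4 * Real.log x) := by
      have := Real.log_le_log (by positivity) ht
      rw [Real.log_pow] at this
      push_cast at this
      linarith
    have hlx : Real.log x ≤ 0 := Real.log_nonpos hx0.le (by linarith)
    have hm := (rationalMoment_zero_one_le_log (t := 4 * x ^ 2 / (1 + 3 * x ^ 2)) (by positivity)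
      (by rw [div_le_iff₀ (by positivity)]; nlinarith)).trans hl
    unfold arcCurvature incircleArcCurvature
    rw [hD, e, Real.rpow_one]
    calc 2 * x / √(1 + 3 * x ^ 2) * rationalMoment 0 1 (4 * x ^ 2 / (1 + 3 * x ^ 2) - 1)
        ≤ 2 * x * -(4 * Real.log x) := by
          refine mul_le_mul (div_le_self (by positivity) hq) hm
            (rationalMoment_pos 0 1 ?_).le (by positivity)
          have : 0 < 4 * x ^ 2 / (1 + 3 * x ^ 2) := by positivity
          linarith
      _ = -8 * (Real.log x * x) := by ring

/-! ### Arcs of Euclidean circles in the upper half-plane -/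

lemma circleMap_im (c : ℂ) (R θ : ℝ) : (circleMap c R θ).im = c.im + R * Real.sin θ := by
  simp [circleMap, Complex.exp_im]

lemma circleMap_re (c : ℂ) (R θ : ℝ) : (circleMap c R θ).re = c.re + R * Real.cos θ := by
  simp [circleMap, Complex.exp_re]

lemma geodesicCurvature_circleMap (c : ℂ) {R : ℝ} (hR : 0 < R) (θ : ℝ) :
    geodesicCurvature (circleMap c R) θ = c.im / R := by
  have h1 : deriv (circleMap c R) = fun θ => circleMap 0 R θ * Complex.I := by
    funext θ; exact deriv_circleMap c R θ
  have h2 : deriv (fun θ => circleMap 0 R θ * Complex.I) θ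
      = circleMap 0 R θ * Complex.I * Complex.I :=
    ((hasDerivAt_circleMap 0 R θ).mul_const Complex.I).deriv
  unfold geodesicCurvature
  rw [h1, h2]
  have hn : ‖circleMap 0 R θ * Complex.I‖ = R := by
    simp [abs_of_pos hR]
  rw [hn, circleMap_im]
  simp only [Complex.mul_im, Complex.mul_re, map_mul, Complex.conj_re, Complex.conj_im,
    Complex.I_re, Complex.I_im, circleMap_im, circleMap_re, Complex.zero_re, Complex.zero_im]
  field_simp
  linear_combination (c.im + R * Real.sin θ) * R ^ 2 * Real.sin_sq_add_cos_sq θ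

lemma isGeneralizedCircle_iff {c : ℂ} {R k : ℝ} (hk : 0 < k) :
    IsGeneralizedCircle c R k ↔ 0 < R ∧ c.im = k * R := by
  constructor
  · rintro ⟨hR, ⟨θ, hθ⟩, h⟩
    refine ⟨hR, ?_⟩
    have := h θ hθ
    rw [geodesicCurvature_circleMap c hR] at this
    rw [← this, div_mul_cancel₀ _ hR.ne']
  · rintro ⟨hR, h⟩
    refine ⟨hR, ⟨Real.pi / 2, ?_⟩, fun θ _ => ?_⟩
    · rw [circleMap_im, h, Real.sin_pi_div_two]; positivity
    · rw [geodesicCurvature_circleMap c hR, h, mul_div_cancel_right₀ _ hR.ne']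

lemma hyperbolicLength_circleMap {c : ℂ} {R k : ℝ} (hR : 0 < R) (hc : c.im = k * R) (α β : ℝ) :
    hyperbolicLength (circleMap c R) α β = ∫ θ in α..β, 1 / (k + Real.sin θ) := by
  unfold hyperbolicLength
  refine intervalIntegral.integral_congr fun θ _ => ?_
  have hn : ‖deriv (circleMap c R) θ‖ = R := by simp [deriv_circleMap, abs_of_pos hR]
  rw [hn, circleMap_im, hc, mul_comm k R, ← mul_add, div_mul_eq_div_div, div_self hR.ne']

lemma hasDerivAt_mul_rationalMoment {a T : ℝ} (h : 0 < 1 + a * T ^ 2) :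
    HasDerivAt (fun T => T * rationalMoment 0 1 (a * T ^ 2)) (1 / (1 + a * T ^ 2)) T := by
  have hy : -1 < a * T ^ 2 := by linarith
  have h1 : HasDerivAt (fun T => a * T ^ 2) (a * (2 * T)) T := by
    simpa using (hasDerivAt_pow 2 T).const_mul a
  have h2 := (hasDerivAt_rationalMoment 0 1 hy).comp T h1
  refine ((hasDerivAt_id T).mul h2).congr_deriv ?_
  rw [← rationalMoment_sub_two_mul hy]
  simp only [id, Function.comp_apply]
  push_cast
  ring

/-- Substitute `T = N / M`, a half-angle quotient that vanishes at `α`. From `(k + sin θ) C = M² +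
(k² - 1) N²` and `T' = C / (2 M²)` the integrand becomes `2 dT / (1 + (k² - 1) T²)`, and `hMD` says
that `T` ends at `1 / √D`. -/
lemma integral_one_div_add_sin {k α β D : ℝ} (hk : 0 < k) (hαβ : α < β) (hβ : β - α < Real.pi)
    (hα : 0 < k + Real.sin α) (hD : 1 ≤ D)
    (hM : 0 < k * Real.cos ((β - α) / 2) + Real.sin ((β + α) / 2))
    (hMD : (k * Real.cos ((β - α) / 2) + Real.sin ((β + α) / 2)) ^ 2
      = D * Real.sin ((β - α) / 2) ^ 2) :
    ∫ θ in α..β, 1 / (k + Real.sin θ) = 2 / √D * rationalMoment 0 1 ((k ^ 2 - 1) / D) := by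
  set C := k + Real.sin α with hC
  set B := Real.cos α with hB
  set N : ℝ → ℝ := fun θ => Real.sin ((θ - α) / 2) with hN
  set M : ℝ → ℝ := fun θ => C * Real.cos ((θ - α) / 2) + B * Real.sin ((θ - α) / 2) with hMdef
  have hMeq : ∀ θ, M θ = k * Real.cos ((θ - α) / 2) + Real.sin ((θ + α) / 2) := fun θ => by
    have : (θ + α) / 2 = (θ - α) / 2 + α := by ring
    rw [this, Real.sin_add]
    simp only [hMdef, hC, hB]
    ring
  rw [← hMeq β] at hM hMD
  have hNβ : 0 < N β := Real.sin_pos_of_pos_of_lt_pi (by linarith) (by linarith)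
  -- Monotonicity of `N / M`, without division. It carries `M > 0` and `N ≤ M` from `β` back to the
  -- whole arc, so that `T` has no pole and `k + sin θ > 0`.
  have hmono : ∀ θ ∈ Set.Icc α β, M β * N θ ≤ M θ * N β := fun θ hθ => by
    have e : M θ * N β - M β * N θ = C * Real.sin ((β - α) / 2 - (θ - α) / 2) := by
      rw [Real.sin_sub]; simp only [hMdef, hN]; ring
    have : 0 ≤ Real.sin ((β - α) / 2 - (θ - α) / 2) :=
      Real.sin_nonneg_of_nonneg_of_le_pi (by linarith [hθ.2]) (by linarith [hθ.1])
    nlinarith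
  have hN0 : ∀ θ ∈ Set.Icc α β, 0 ≤ N θ := fun θ hθ =>
    Real.sin_nonneg_of_nonneg_of_le_pi (by linarith [hθ.1]) (by linarith [hθ.2])
  have hMpos : ∀ θ ∈ Set.Icc α β, 0 < M θ := fun θ hθ => by
    rcases hθ.1.eq_or_lt with h | h
    · simp [hMdef, ← h, hα]
    · have : 0 < N θ :=
        Real.sin_pos_of_pos_of_lt_pi (by linarith) (by linarith [hθ.2])
      have := (mul_pos hM this).trans_le (hmono θ hθ)
      exact pos_of_mul_pos_left this hNβ.le
  have hTD : N β / M β = 1 / √D := by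
    rw [← Real.sqrt_sq hM.le, hMD, Real.sqrt_mul (by linarith), Real.sqrt_sq hNβ.le]
    have : 0 < √D := Real.sqrt_pos.2 (by linarith)
    change N β / (√D * N β) = _
    field_simp
  have hT1 : ∀ θ ∈ Set.Icc α β, N θ ^ 2 ≤ M θ ^ 2 := fun θ hθ => by
    have h1 : N β ^ 2 ≤ M β ^ 2 := by
      rw [hMD]; exact le_mul_of_one_le_left (sq_nonneg _) hD
    have h2 : N β ≤ M β := (sq_le_sq₀ hNβ.le hM.le).1 h1
    have h3 := hmono θ hθ
    have h4 : N θ ≤ M θ := by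
      have := mul_le_mul_of_nonneg_right h2 (hN0 θ hθ)
      exact le_of_mul_le_mul_right (by linarith : N θ * N β ≤ M θ * N β) hNβ
    exact (sq_le_sq₀ (hN0 θ hθ) (hMpos θ hθ).le).2 h4
  have hident : ∀ θ, (k + Real.sin θ) * C = M θ ^ 2 + (k ^ 2 - 1) * N θ ^ 2 := fun θ => by
    have e : θ = α + 2 * ((θ - α) / 2) := by ring
    have h1 := Real.sin_sq_add_cos_sq ((θ - α) / 2)
    have h2 := Real.sin_sq_add_cos_sq α
    have hs : Real.sin θ = Real.sin α * (2 * Real.cos ((θ - α) / 2) ^ 2 - 1)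
        + Real.cos α * (2 * Real.sin ((θ - α) / 2) * Real.cos ((θ - α) / 2)) := by
      conv_lhs => rw [e, Real.sin_add, Real.sin_two_mul, Real.cos_two_mul]
    rw [hs]
    simp only [hMdef, hN, hC, hB]
    generalize Real.sin ((θ - α) / 2) = s at *
    generalize Real.cos ((θ - α) / 2) = d at *
    generalize Real.sin α = u at *
    generalize Real.cos α = v at *
    have hs2 : s ^ 2 = 1 - d ^ 2 := by linarith
    have hv2 : v ^ 2 = 1 - u ^ 2 := by linarith
    ring_nf
    rw [hs2, hv2]
    ring
  have hden : ∀ θ ∈ Set.Icc α β, 0 < M θ ^ 2 + (k ^ 2 - 1) * N θ ^ 2 := fun θ hθ => by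
    rcases (hN0 θ hθ).eq_or_lt with h | h
    · rw [← h]; linarith [pow_pos (hMpos θ hθ) 2]
    · have := hT1 θ hθ
      have : 0 < k ^ 2 * N θ ^ 2 := by positivity
      linarith
  have hks : ∀ θ ∈ Set.Icc α β, 0 < k + Real.sin θ := fun θ hθ =>
    pos_of_mul_pos_left ((hident θ).symm ▸ hden θ hθ) hα.le
  have hT : ∀ θ ∈ Set.uIcc α β, HasDerivAt
      (fun θ => 2 * (N θ / M θ * rationalMoment 0 1 ((k ^ 2 - 1) * (N θ / M θ) ^ 2)))
      (1 / (k + Real.sin θ)) θ := by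
    intro θ hθ
    rw [Set.uIcc_of_le hαβ.le] at hθ
    have hMθ := hMpos θ hθ
    have hφ : HasDerivAt (fun θ : ℝ => (θ - α) / 2) (1 / 2) θ :=
      ((hasDerivAt_id θ).sub_const α).div_const 2
    have hN' : HasDerivAt N (Real.cos ((θ - α) / 2) * (1 / 2)) θ := hφ.sin
    have hM' : HasDerivAt M (C * (-Real.sin ((θ - α) / 2) * (1 / 2))
        + B * (Real.cos ((θ - α) / 2) * (1 / 2))) θ :=
      (hφ.cos.const_mul C).add (hφ.sin.const_mul B)
    have hT' : HasDerivAt (fun θ => N θ / M θ) (C / 2 / M θ ^ 2) θ := by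
      refine (hN'.div hM' hMθ.ne').congr_deriv ?_
      congr 1
      have h1 := Real.sin_sq_add_cos_sq ((θ - α) / 2)
      simp only [hMdef, hN]
      linear_combination C / 2 * h1
    have hpos : 0 < 1 + (k ^ 2 - 1) * (N θ / M θ) ^ 2 := by
      have := hden θ hθ
      have e : 1 + (k ^ 2 - 1) * (N θ / M θ) ^ 2
          = (M θ ^ 2 + (k ^ 2 - 1) * N θ ^ 2) / M θ ^ 2 := by field_simp
      rw [e]; positivity
    have := ((hasDerivAt_mul_rationalMoment hpos).comp θ hT').const_mul 2
    refine this.congr_deriv ?_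
    have e : 1 + (k ^ 2 - 1) * (N θ / M θ) ^ 2 = (k + Real.sin θ) * C / M θ ^ 2 := by
      rw [hident]; field_simp
    rw [e]
    have := hks θ hθ
    field_simp
  have hcont : ContinuousOn (fun θ => 1 / (k + Real.sin θ)) (Set.uIcc α β) := by
    refine ContinuousOn.div (by fun_prop) (by fun_prop) fun θ hθ => ?_
    rw [Set.uIcc_of_le hαβ.le] at hθ
    exact (hks θ hθ).ne'
  rw [intervalIntegral.integral_eq_sub_of_hasDerivAt hT hcont.intervalIntegrable, hTD]
  have hNα : N α = 0 := by simp [hN]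
  rw [hNα, div_pow, Real.sq_sqrt (by linarith)]
  ring_nf

/-- The data of the angle at the centre of the first of three mutually tangent generalized circles
determine the hyperbolic length of the corresponding arc. -/
lemma integral_one_div_add_sin_of_tangent_of_lt {k kj kl R Rj Rl α β : ℝ} (hk : 0 < k)
    (hkj : 0 < kj) (hkl : 0 < kl) (hR : 0 < R) (hRj : 0 < Rj) (hRl : 0 < Rl)
    (hα : (R + Rj) * Real.sin α = kj * Rj - k * R) (hβ : (R + Rl) * Real.sin β = kl * Rl - k * R)
    (hcos : (R + Rj) * (R + Rl) * (1 - Real.cos (β - α)) = 2 * Rj * Rl)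
    (hαβ : α < β) (hπ : β - α < Real.pi) :
    ∫ θ in α..β, 1 / (k + Real.sin θ) = 2 / √(incircleCurvatureSq k kj kl)
      * rationalMoment 0 1 ((k ^ 2 - 1) / incircleCurvatureSq k kj kl) := by
  have hα' : k + Real.sin α = Rj * (k + kj) / (R + Rj) := by
    field_simp; linarith
  have hβ' : k + Real.sin β = Rl * (k + kl) / (R + Rl) := by
    field_simp; linarith
  have hcos' : 1 - Real.cos (β - α) = 2 * (Rj * Rl / ((R + Rj) * (R + Rl))) := by
    field_simp; linarith
  set φ := (β - α) / 2 with hφ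
  set ψ := (β + α) / 2 with hψ
  have eβ : β = ψ + φ := by rw [hφ, hψ]; ring
  have eα : α = ψ - φ := by rw [hφ, hψ]; ring
  have hc : 0 < Real.cos φ := Real.cos_pos_of_mem_Ioo ⟨by linarith [Real.pi_pos], by linarith⟩
  have hsin2 : Real.sin φ ^ 2 = Rj * Rl / ((R + Rj) * (R + Rl)) := by
    have : β - α = 2 * φ := by rw [hφ]; ring
    rw [this, Real.cos_two_mul] at hcos'
    have := Real.sin_sq_add_cos_sq φ
    linarith
  -- The right side is `(k + kj)(k + kl) sin² φ`, and `(k + kj)(k + kl) - (k² - 1)` is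
  -- `incircleCurvatureSq`.
  have hprod : (k * Real.cos φ + Real.sin ψ) ^ 2 + (k ^ 2 - 1) * Real.sin φ ^ 2
      = (k + Real.sin α) * (k + Real.sin β) := by
    rw [eα, eβ, Real.sin_sub, Real.sin_add]
    have h1 := Real.sin_sq_add_cos_sq φ
    have h2 := Real.sin_sq_add_cos_sq ψ
    generalize Real.sin φ = s at *
    generalize Real.cos φ = d at *
    generalize Real.sin ψ = u at *
    generalize Real.cos ψ = v at *
    have hs2 : s ^ 2 = 1 - d ^ 2 := by linarith
    have hv2 : v ^ 2 = 1 - u ^ 2 := by linarith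
    ring_nf
    rw [hs2, hv2]
    ring
  have hM2 : (k * Real.cos φ + Real.sin ψ) ^ 2 = incircleCurvatureSq k kj kl * Real.sin φ ^ 2 := by
    rw [hα', hβ'] at hprod
    have : (k * Real.cos φ + Real.sin ψ) ^ 2 = Rj * (k + kj) / (R + Rj) * (Rl * (k + kl) / (R + Rl))
        - (k ^ 2 - 1) * Real.sin φ ^ 2 := by linarith
    rw [this, hsin2]
    unfold incircleCurvatureSq
    field_simp
    ring
  -- The square leaves the sign open; multiplication by `2 cos φ > 0` gives a visibly positive
  -- fraction.
  have hMpos : 0 < k * Real.cos φ + Real.sin ψ := by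
    have e : 2 * Real.cos φ * (k * Real.cos φ + Real.sin ψ)
        = (k + Real.sin α) + (k + Real.sin β) - 2 * k * Real.sin φ ^ 2 := by
      rw [eα, eβ, Real.sin_sub, Real.sin_add]
      linear_combination 2 * k * Real.sin_sq_add_cos_sq φ
    have e2 : (k + Real.sin α) + (k + Real.sin β) - 2 * k * Real.sin φ ^ 2
        = (k * R * (Rj + Rl) + kj * Rj * (R + Rl) + kl * Rl * (R + Rj))
          / ((R + Rj) * (R + Rl)) := by
      rw [hα', hβ', hsin2]
      field_simp
      ring
    rw [e2] at e
    have : 0 < 2 * Real.cos φ * (k * Real.cos φ + Real.sin ψ) := by rw [e]; positivity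
    exact pos_of_mul_pos_right this (by positivity)
  refine integral_one_div_add_sin hk hαβ hπ (by rw [hα']; positivity) ?_ hMpos hM2
  unfold incircleCurvatureSq
  nlinarith [mul_pos hk hkj, mul_pos hk hkl, mul_pos hkj hkl]

lemma abs_integral_one_div_add_sin_of_tangent {k kj kl R Rj Rl α β : ℝ} (hk : 0 < k)
    (hkj : 0 < kj) (hkl : 0 < kl) (hR : 0 < R) (hRj : 0 < Rj) (hRl : 0 < Rl)
    (hα : (R + Rj) * Real.sin α = kj * Rj - k * R) (hβ : (R + Rl) * Real.sin β = kl * Rl - k * R)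
    (hcos : (R + Rj) * (R + Rl) * (1 - Real.cos (β - α)) = 2 * Rj * Rl)
    (hπ : |β - α| < Real.pi) :
    |∫ θ in α..β, 1 / (k + Real.sin θ)| = 2 / √(incircleCurvatureSq k kj kl)
      * rationalMoment 0 1 ((k ^ 2 - 1) / incircleCurvatureSq k kj kl) := by
  rw [abs_lt] at hπ
  have hnn : 0 ≤ 2 / √(incircleCurvatureSq k kj kl)
      * rationalMoment 0 1 ((k ^ 2 - 1) / incircleCurvatureSq k kj kl) :=
    mul_nonneg (by positivity) (rationalMoment_pos 0 1 (incircleCurvatureSq_ratio hk hkj hkl)).le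
  rcases lt_trichotomy α β with h | h | h
  · rw [integral_one_div_add_sin_of_tangent_of_lt hk hkj hkl hR hRj hRl hα hβ hcos h hπ.2,
      abs_of_nonneg hnn]
  · rw [h, sub_self, Real.cos_zero, sub_self, mul_zero] at hcos
    have : 0 < 2 * Rj * Rl := by positivity
    linarith
  · have e : incircleCurvatureSq k kl kj = incircleCurvatureSq k kj kl := by
      unfold incircleCurvatureSq; ring
    rw [intervalIntegral.integral_symm, abs_neg,
      integral_one_div_add_sin_of_tangent_of_lt hk hkl hkj hR hRl hRj hβ hα
        (by rw [← Real.cos_neg, neg_sub]; linarith) h (by linarith), e, abs_of_nonneg hnn]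

/-! ### Three-circle configurations -/

/-- The unit vector at angle `α` has inner product `R + r = |d - c|` with `d - c`, so equality in
Cauchy–Schwarz makes the two parallel. -/
lemma direction_of_tangent {c d : ℂ} {R r α : ℝ} (hd : dist c d = R + r) (hR : 0 < R)
    (h : circleMap c R α ∈ Metric.sphere d r) :
    (R + r) * Real.cos α = d.re - c.re ∧ (R + r) * Real.sin α = d.im - c.im := by
  rw [Metric.mem_sphere, Complex.dist_eq_re_im, circleMap_re, circleMap_im] at h
  rw [Complex.dist_eq_re_im] at hd
  have h2 : (c.re + R * Real.cos α - d.re) ^ 2 + (c.im + R * Real.sin α - d.im) ^ 2 = r ^ 2 := by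
    rw [← h, Real.sq_sqrt (by positivity)]
  have hd2 : (c.re - d.re) ^ 2 + (c.im - d.im) ^ 2 = (R + r) ^ 2 := by
    rw [← hd, Real.sq_sqrt (by positivity)]
  have hs := Real.sin_sq_add_cos_sq α
  have hin : (d.re - c.re) * Real.cos α + (d.im - c.im) * Real.sin α = R + r := by
    have : R * ((d.re - c.re) * Real.cos α + (d.im - c.im) * Real.sin α - (R + r)) = 0 := by
      linear_combination (hd2 - h2 + R ^ 2 * hs) / 2
    have := (mul_eq_zero.1 this).resolve_left hR.ne'
    linarith
  have hsum : ((R + r) * Real.cos α - (d.re - c.re)) ^ 2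
      + ((R + r) * Real.sin α - (d.im - c.im)) ^ 2 = 0 := by
    linear_combination (R + r) ^ 2 * hs - 2 * (R + r) * hin + hd2
  obtain ⟨h1, h3⟩ := (add_eq_zero_iff_of_nonneg (sq_nonneg _) (sq_nonneg _)).1 hsum
  exact ⟨sub_eq_zero.1 (pow_eq_zero_iff two_ne_zero |>.1 h1),
    sub_eq_zero.1 (pow_eq_zero_iff two_ne_zero |>.1 h3)⟩

lemma IsTangencyArcLength.eq {k : Fin 3 → ℝ} (hk : ∀ j, 0 < k j) {i : Fin 3} {ℓ : ℝ}
    (h : IsTangencyArcLength k i ℓ) :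
    ℓ = 2 / √(incircleCurvatureSq (k i) (k (i + 1)) (k (i + 2)))
      * rationalMoment 0 1
        ((k i ^ 2 - 1) / incircleCurvatureSq (k i) (k (i + 1)) (k (i + 2))) := by
  obtain ⟨c, R, α, β, hc, hα, hβ, hπ, rfl⟩ := h
  have hcirc := fun j => (isGeneralizedCircle_iff (hk j)).1 (hc.circle j)
  have hij : i ≠ i + 1 := by fin_cases i <;> decide
  have hil : i ≠ i + 2 := by fin_cases i <;> decide
  have hjl : i + 1 ≠ i + 2 := by fin_cases i <;> decide
  have hRi := (hcirc i).1
  have hRj := (hcirc (i + 1)).1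
  have hRl := (hcirc (i + 2)).1
  obtain ⟨hαc, hαs⟩ := direction_of_tangent (hc.tangent _ _ hij) hRi hα
  obtain ⟨hβc, hβs⟩ := direction_of_tangent (hc.tangent _ _ hil) hRi hβ
  have hjl' := hc.tangent _ _ hjl
  rw [hyperbolicLength_circleMap hRi (hcirc i).2]
  refine abs_integral_one_div_add_sin_of_tangent (hk i) (hk _) (hk _) hRi hRj hRl
    (by rw [hαs, (hcirc _).2, (hcirc _).2]) (by rw [hβs, (hcirc _).2, (hcirc _).2]) ?_ hπ
  rw [Complex.dist_eq_re_im] at hjl'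
  have hd2 : ((c (i + 1)).re - (c (i + 2)).re) ^ 2 + ((c (i + 1)).im - (c (i + 2)).im) ^ 2
      = (R (i + 1) + R (i + 2)) ^ 2 := by
    rw [← hjl', Real.sq_sqrt (by positivity)]
  have e1 : (c (i + 1)).re - (c (i + 2)).re
      = (R i + R (i + 1)) * Real.cos α - (R i + R (i + 2)) * Real.cos β := by linarith
  have e2 : (c (i + 1)).im - (c (i + 2)).im
      = (R i + R (i + 1)) * Real.sin α - (R i + R (i + 2)) * Real.sin β := by linarith
  -- The law of cosines in the triangle of centres.
  rw [e1, e2] at hd2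
  rw [Real.cos_sub]
  linear_combination (hd2 - (R i + R (i + 1)) ^ 2 * Real.sin_sq_add_cos_sq α
    - (R i + R (i + 2)) ^ 2 * Real.sin_sq_add_cos_sq β) / 2

/-- Curvatures `a, b` with radii `b, a` put two centres at the same height `ab`. The difference of
the other two tangency equations is linear and gives `m`. With `t = ab / r` and `s = (t - x)(a + b)`
there remains `s² - 4s = 4(xa + xb + ab)`, with positive root `s = 2(1 + q)`. -/
lemma exists_isThreeCircleConfiguration {k : Fin 3 → ℝ} (hk : ∀ j, 0 < k j) :
    ∃ c R, IsThreeCircleConfiguration k c R := by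
  obtain ⟨a, ha⟩ : ∃ a, a = k 0 := ⟨_, rfl⟩
  obtain ⟨b, hb⟩ : ∃ b, b = k 1 := ⟨_, rfl⟩
  obtain ⟨x, hx⟩ : ∃ x, x = k 2 := ⟨_, rfl⟩
  have ha0 : 0 < a := ha ▸ hk 0
  have hb0 : 0 < b := hb ▸ hk 1
  have hx0 : 0 < x := hx ▸ hk 2
  set q := √(incircleCurvatureSq x a b) with hq
  have hq0 : 0 < q := Real.sqrt_pos.2 (incircleCurvatureSq_pos hx0 ha0 hb0)
  have hq2 : q ^ 2 = 1 + x * a + x * b + a * b :=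
    Real.sq_sqrt (incircleCurvatureSq_pos hx0 ha0 hb0).le
  set t := x + 2 * (1 + q) / (a + b) with ht
  have ht0 : 0 < t := by positivity
  set r := a * b / t with hr
  have hr0 : 0 < r := by positivity
  set m := b + r * (b - a) / (a + b) with hm
  have key : m ^ 2 + (x * r - a * b) ^ 2 = (r + b) ^ 2 := by
    have hab : a * b = r * t := by rw [hr]; field_simp
    have hs : (a + b) * t = x * (a + b) + 2 * (1 + q) := by rw [ht]; field_simp
    have h4 : (t - x) ^ 2 * (a + b) - 4 * (t - x) - 4 * x = 4 * (a * b) / (a + b) := by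
      have : t - x = 2 * (1 + q) / (a + b) := by rw [ht]; ring
      rw [this]
      field_simp
      linear_combination 4 * hq2
    have h5 : (t - x) ^ 2 - 4 * t / (a + b) = 4 * (a * b) / (a + b) ^ 2 := by
      field_simp at h4 ⊢
      linear_combination h4
    have h6 : m ^ 2 - (r + b) ^ 2
        = -(4 * a * r * b / (a + b)) - 4 * a * b * r ^ 2 / (a + b) ^ 2 := by
      rw [hm]; field_simp; ring
    have h7 : x * r - a * b = -(r * (t - x)) := by rw [hab]; ring
    rw [h7]
    have h8 : 4 * a * r * b / (a + b) = r ^ 2 * (4 * t / (a + b)) := by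
      have : 4 * a * r * b = 4 * r * (a * b) := by ring
      rw [this, hab]; ring
    linear_combination h6 + r ^ 2 * h5 - h8
  have key2 : (m - (a + b)) ^ 2 + (x * r - a * b) ^ 2 = (r + a) ^ 2 := by
    have : (m - (a + b)) ^ 2 = m ^ 2 - (r + b) ^ 2 + (r + a) ^ 2 := by
      rw [hm]; field_simp; ring
    linarith
  have d01 : dist (⟨0, a * b⟩ : ℂ) ⟨a + b, a * b⟩ = b + a := by
    rw [Complex.dist_eq_re_im]
    simp only [zero_sub, even_two, Even.neg_pow, sub_self, ne_eq, OfNat.ofNat_ne_zero,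
      not_false_eq_true, zero_pow, add_zero]
    rw [Real.sqrt_sq (by positivity), add_comm]
  have d20 : dist (⟨m, x * r⟩ : ℂ) ⟨0, a * b⟩ = r + b := by
    rw [Complex.dist_eq_re_im]
    simp only [sub_zero]
    rw [key, Real.sqrt_sq (by positivity)]
  have d21 : dist (⟨m, x * r⟩ : ℂ) ⟨a + b, a * b⟩ = r + a := by
    rw [Complex.dist_eq_re_im]
    simp only
    rw [key2, Real.sqrt_sq (by positivity)]
  refine ⟨![⟨0, a * b⟩, ⟨a + b, a * b⟩, ⟨m, x * r⟩], ![b, a, r], fun j => ?_, fun i j hij => ?_⟩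
  · rw [isGeneralizedCircle_iff (hk j)]
    fin_cases j
    · exact ⟨hb0, by simp [ha]⟩
    · exact ⟨ha0, by simp [hb, mul_comm]⟩
    · exact ⟨hr0, by simp [hx]⟩
  · fin_cases i <;> fin_cases j <;> first | exact absurd rfl hij | skip
    · exact d01
    · rw [dist_comm]; exact d20.trans (add_comm _ _)
    · rw [dist_comm]; exact d01.trans (add_comm _ _)
    · rw [dist_comm]; exact d21.trans (add_comm _ _)
    · exact d20
    · exact d21

lemma circleMap_mem_sphere_of_direction {c d : ℂ} {R r α : ℝ} (hr : 0 < r)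
    (h : d - c = (R + r : ℝ) * Complex.exp (α * Complex.I)) :
    circleMap c R α ∈ Metric.sphere d r := by
  rw [Metric.mem_sphere, dist_comm, Complex.dist_eq]
  have : d - circleMap c R α = r * Complex.exp (α * Complex.I) := by
    rw [circleMap, sub_add_eq_sub_sub, h]; push_cast; ring
  rw [this, norm_mul, Complex.norm_exp_ofReal_mul_I, Complex.norm_real, mul_one,
    Real.norm_of_nonneg hr.le]

lemma exists_isTangencyArcLength {k : Fin 3 → ℝ} (hk : ∀ j, 0 < k j) (i : Fin 3) :
    ∃ ℓ, IsTangencyArcLength k i ℓ := by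
  obtain ⟨c, R, hc⟩ := exists_isThreeCircleConfiguration hk
  have hij : i ≠ i + 1 := by fin_cases i <;> decide
  have hil : i ≠ i + 2 := by fin_cases i <;> decide
  have hjl : i + 1 ≠ i + 2 := by fin_cases i <;> decide
  have hRi := (hc.circle i).radius_pos
  have hRj := (hc.circle (i + 1)).radius_pos
  have hRl := (hc.circle (i + 2)).radius_pos
  set z := c (i + 1) - c i with hz
  set w := c (i + 2) - c i with hw
  have hzn : ‖z‖ = R i + R (i + 1) := by
    rw [hz, ← Complex.dist_eq, dist_comm]; exact hc.tangent _ _ hij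
  have hwn : ‖w‖ = R i + R (i + 2) := by
    rw [hw, ← Complex.dist_eq, dist_comm]; exact hc.tangent _ _ hil
  have hzw : ‖z - w‖ = R (i + 1) + R (i + 2) := by
    rw [hz, hw, sub_sub_sub_cancel_right, ← Complex.dist_eq]; exact hc.tangent _ _ hjl
  have hz0 : z ≠ 0 := by rw [← norm_pos_iff, hzn]; positivity
  -- An angle `π` would put the centre of circle `i` between the two others, whose distance would
  -- then exceed the sum of their radii.
  have harg : (w / z).arg ≠ Real.pi := by
    intro h
    obtain ⟨hre, him⟩ := Complex.arg_eq_pi_iff.1 h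
    have hwz : w = ((w / z).re : ℂ) * z := by
      have : ((w / z).re : ℂ) = w / z := Complex.ext rfl (by simp [him])
      rw [this, div_mul_cancel₀ _ hz0]
    have h1 : ‖w‖ = -(w / z).re * ‖z‖ := by
      conv_lhs => rw [hwz, norm_mul, Complex.norm_real, Real.norm_of_nonpos hre.le]
    have h2 : ‖z - w‖ = (1 - (w / z).re) * ‖z‖ := by
      have : z - w = ((1 - (w / z).re : ℝ) : ℂ) * z := by
        conv_lhs => rw [hwz]
        push_cast; ring
      rw [this, norm_mul, Complex.norm_real, Real.norm_of_nonneg (by linarith)]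
    have : ‖z - w‖ = ‖z‖ + ‖w‖ := by rw [h1, h2]; ring
    rw [hzw, hzn, hwn] at this
    linarith
  refine ⟨_, c, R, z.arg, z.arg + (w / z).arg, hc, circleMap_mem_sphere_of_direction hRj ?_,
    circleMap_mem_sphere_of_direction hRl ?_, ?_, rfl⟩
  · rw [← hzn]; exact (Complex.norm_mul_exp_arg_mul_I z).symm
  · have e1 := Complex.norm_mul_exp_arg_mul_I z
    have e2 := Complex.norm_mul_exp_arg_mul_I (w / z)
    rw [← hwn]
    change w = _
    push_cast
    rw [add_mul, Complex.exp_add]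
    have : (‖w‖ : ℂ) = ‖z‖ * ‖w / z‖ := by
      rw [← Complex.ofReal_mul, ← norm_mul, mul_div_cancel₀ _ hz0]
    rw [this]
    calc w = z * (w / z) := (mul_div_cancel₀ _ hz0).symm
      _ = (‖z‖ * Complex.exp (z.arg * Complex.I))
          * (‖w / z‖ * Complex.exp ((w / z).arg * Complex.I)) := by rw [e1, e2]
      _ = _ := by ring
  · rw [add_sub_cancel_left, abs_lt]
    exact ⟨Complex.neg_pi_lt_arg _, lt_of_le_of_ne (Complex.arg_le_pi _) harg⟩

lemma tangencyArcLength_mul {k : Fin 3 → ℝ} (hk : ∀ j, 0 < k j) (i : Fin 3) :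
    tangencyArcLength k i * k i = arcCurvature (k i) (k (i + 1)) (k (i + 2)) := by
  obtain ⟨ℓ, hℓ⟩ := exists_isTangencyArcLength hk i
  have : {ℓ : ℝ | IsTangencyArcLength k i ℓ} = {ℓ} :=
    Set.eq_singleton_iff_unique_mem.2 ⟨hℓ, fun ℓ' hℓ' => by rw [hℓ'.eq hk, hℓ.eq hk]⟩
  rw [tangencyArcLength, this, csInf_singleton, hℓ.eq hk, arcCurvature, incircleArcCurvature]
  ring

/-! ### Total curvatures at the corners, faces and vertices of the triangulation -/

namespace TriangulatedSurface

variable {V F : Type*} (T : TriangulatedSurface V F)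

/-- The total geodesic curvature of the arc at the corner `c` of the face `f`. -/
def cornerCurvature (k : V → ℝ) (f : F) (c : Fin 3) : ℝ :=
  arcCurvature (k (T.vert f c)) (k (T.vert f (c + 1))) (k (T.vert f (c + 2)))

open Classical in
/-- The sum of the total geodesic curvatures of the arcs at the vertex `v`. -/
def vertexCurvature [Fintype F] (k : V → ℝ) (v : V) : ℝ :=
  ∑ f : F, ∑ c : Fin 3, if T.vert f c = v then T.cornerCurvature k f c else 0

lemma totalGeodesicCurvature_eq [Fintype F] {k : V → ℝ} (hk : ∀ v, 0 < k v) (v : V) :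
    T.totalGeodesicCurvature k v = T.vertexCurvature k v := by
  unfold totalGeodesicCurvature circleLength vertexCurvature
  rw [Finset.sum_mul]
  refine Finset.sum_congr rfl fun f _ => ?_
  rw [Finset.sum_mul]
  refine Finset.sum_congr rfl fun c _ => ?_
  split_ifs with h
  · rw [← h]
    exact tangencyArcLength_mul (k := fun j => k (T.vert f j)) (fun j => hk _) c
  · rw [zero_mul]

lemma cornerCurvature_pos {k : V → ℝ} (hk : ∀ v, 0 < k v) (f : F) (c : Fin 3) :
    0 < T.cornerCurvature k f c :=
  arcCurvature_pos (hk _) (hk _) (hk _)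

lemma sum_cornerCurvature (k : V → ℝ) (f : F) (d : Fin 3) :
    ∑ c, T.cornerCurvature k f c = interstitialCurvature (k (T.vert f d))
      (k (T.vert f (d + 1))) (k (T.vert f (d + 2))) := by
  have : ∑ c, T.cornerCurvature k f c = interstitialCurvature (k (T.vert f 0))
      (k (T.vert f 1)) (k (T.vert f 2)) := by
    rw [Fin.sum_univ_three]; rfl
  rw [this]
  fin_cases d
  · rfl
  · exact interstitialCurvature_rotate _ _ _
  · exact (interstitialCurvature_rotate _ _ _).trans (interstitialCurvature_rotate _ _ _)

/-- A corner off `I` has curvature at most `B` and the corner `d`, of curvature at least `M`, as a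
neighbour, so its arc is negligible for large `M`; the corners in `I` then carry almost the full
`π`. -/
lemma le_sum_cornerCurvature {k : V → ℝ} {ε M B : ℝ} {I : Finset V} {f : F} {d : Fin 3}
    (hε : 0 < ε) (hM : 0 < M) (hkε : ∀ v, ε ≤ k v) (hkM : ∀ v ∈ I, M ≤ k v)
    (hkB : ∀ v, v ∉ I → k v ≤ B) (hB : 0 < B) (hd : T.vert f d ∈ I) :
    interstitialCurvature M ε ε - 3 * arcCurvature B M ε
      ≤ ∑ c, open Classical in if T.vert f c ∈ I then T.cornerCurvature k f c else 0 := by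
  classical
  have hk : ∀ v, 0 < k v := fun v => hε.trans_le (hkε v)
  have h1 : ∑ c, T.cornerCurvature k f c - ∑ _c : Fin 3, arcCurvature B M ε
      ≤ ∑ c, if T.vert f c ∈ I then T.cornerCurvature k f c else 0 := by
    rw [← Finset.sum_sub_distrib]
    refine Finset.sum_le_sum fun c _ => ?_
    split_ifs with hc
    · linarith [arcCurvature_pos hB hM hε]
    · rw [sub_nonpos]
      refine (arcCurvature_mono_self (hk _) (hk _) (hk _) (hkB _ hc)).trans ?_
      have hcd : d = c + 1 ∨ d = c + 2 := by
        have : d ≠ c := fun h => hc (h ▸ hd)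
        revert this
        clear hd hc
        revert c d
        decide
      rcases hcd with rfl | rfl
      · exact arcCurvature_antitone hB hM hε (hkM _ hd) (hkε _)
      · rw [arcCurvature_comm B (k _)]
        exact arcCurvature_antitone hB hM hε (hkM _ hd) (hkε _)
  rw [T.sum_cornerCurvature k f d] at h1
  have h2 := interstitialCurvature_mono hM hε hε (hkM _ hd) (hkε (T.vert f (d + 1)))
    (hkε (T.vert f (d + 2)))
  simp only [Finset.sum_const, Finset.card_univ, Fintype.card_fin, nsmul_eq_mul] at h1
  push_cast at h1
  linarith

section

variable [Fintype F]

lemma vertexCurvature_mono_of {k k' : V → ℝ} {v : V}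
    (h : ∀ f c, T.vert f c = v → T.cornerCurvature k f c ≤ T.cornerCurvature k' f c) :
    T.vertexCurvature k v ≤ T.vertexCurvature k' v := by
  refine Finset.sum_le_sum fun f _ => Finset.sum_le_sum fun c _ => ?_
  split_ifs with hv
  · exact h f c hv
  · exact le_rfl

lemma vertexCurvature_strictMono_of {k k' : V → ℝ} {v : V}
    (h : ∀ f c, T.vert f c = v → T.cornerCurvature k f c < T.cornerCurvature k' f c) :
    T.vertexCurvature k v < T.vertexCurvature k' v := by
  classical
  have hle : ∀ f c, (if T.vert f c = v then T.cornerCurvature k f c else 0)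
      ≤ if T.vert f c = v then T.cornerCurvature k' f c else 0 := fun f c => by
    split_ifs with hv
    · exact (h f c hv).le
    · exact le_rfl
  obtain ⟨f, c, hv⟩ := T.vert_surj v
  refine Finset.sum_lt_sum (fun f _ => Finset.sum_le_sum fun c _ => hle f c)
    ⟨f, Finset.mem_univ _, Finset.sum_lt_sum (fun c _ => hle f c) ⟨c, Finset.mem_univ _, ?_⟩⟩
  rw [if_pos hv, if_pos hv]
  exact h f c hv

lemma vertexCurvature_pos {k : V → ℝ} (hk : ∀ v, 0 < k v) (v : V) :
    0 < T.vertexCurvature k v := by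
  classical
  have hle : ∀ f c, 0 ≤ (if T.vert f c = v then T.cornerCurvature k f c else 0) := fun f c => by
    split_ifs
    · exact (T.cornerCurvature_pos hk f c).le
    · exact le_rfl
  obtain ⟨f, c, hv⟩ := T.vert_surj v
  refine Finset.sum_pos' (fun f _ => Finset.sum_nonneg fun c _ => hle f c)
    ⟨f, Finset.mem_univ _, Finset.sum_pos' (fun c _ => hle f c) ⟨c, Finset.mem_univ _, ?_⟩⟩
  rw [if_pos hv]
  exact T.cornerCurvature_pos hk f c

lemma vertexCurvature_le_of {k : V → ℝ} {B : ℝ} {v : V} (hB : 0 ≤ B)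
    (h : ∀ f c, T.cornerCurvature k f c ≤ B) :
    T.vertexCurvature k v ≤ Fintype.card F * (3 * B) := by
  classical
  have : ∀ f ∈ Finset.univ, ∑ c, (if T.vert f c = v then T.cornerCurvature k f c else 0)
      ≤ 3 * B := fun f _ => by
    refine (Finset.sum_le_card_nsmul Finset.univ _ B fun c _ => ?_).trans (by simp)
    split_ifs
    · exact h f c
    · exact hB
  refine (Finset.sum_le_card_nsmul Finset.univ _ _ this).trans (by simp [Finset.card_univ])

/-- The monotonicity behind Perron's method and every comparison argument: at the corners of `v`
only neighbours can change. It covers faces with several corners at `v`. -/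
lemma vertexCurvature_antitone {k k' : V → ℝ} {v : V} (hk : ∀ v, 0 < k v) (h : k ≤ k')
    (hv : k v = k' v) : T.vertexCurvature k' v ≤ T.vertexCurvature k v := by
  refine T.vertexCurvature_mono_of fun f c hc => ?_
  unfold cornerCurvature
  rw [hc, ← hv]
  exact arcCurvature_antitone (hk _) (hk _) (hk _) (h _) (h _)

lemma vertexCurvature_scale_lt {k : V → ℝ} {v : V} (hk : ∀ v, 0 < k v) {t : ℝ} (ht : 1 < t) :
    T.vertexCurvature k v < T.vertexCurvature (fun v => t * k v) v := by
  refine T.vertexCurvature_strictMono_of fun f c _ => ?_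
  have := strictMonoOn_arcCurvature_scale (hk (T.vert f c)) (hk (T.vert f (c + 1)))
    (hk (T.vert f (c + 2))) (Set.mem_Ioi.2 one_pos) (Set.mem_Ioi.2 (one_pos.trans ht)) ht
  simpa only [one_mul, cornerCurvature] using this

lemma contDiffAt_vertexCurvature [Fintype V] {k : V → ℝ} (hk : ∀ v, 0 < k v) (v : V) :
    ContDiffAt ℝ 1 (fun k => T.vertexCurvature k v) k := by
  unfold vertexCurvature
  refine ContDiffAt.sum fun f _ => ContDiffAt.sum fun c _ => ?_
  split_ifs
  · have h1 : ContDiffAt ℝ 1 (fun k : V → ℝ =>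
        (k (T.vert f c), k (T.vert f (c + 1)), k (T.vert f (c + 2)))) k := by fun_prop
    exact ContDiffAt.comp (g := fun p : ℝ × ℝ × ℝ => arcCurvature p.1 p.2.1 p.2.2) k
      (contDiffAt_arcCurvature (hk _) (hk _) (hk _)) h1
  · exact contDiffAt_const

open Classical in
lemma sum_vertexCurvature (k : V → ℝ) (I : Finset V) :
    ∑ v ∈ I, T.vertexCurvature k v
      = ∑ f, ∑ c, if T.vert f c ∈ I then T.cornerCurvature k f c else 0 := by
  unfold vertexCurvature
  rw [Finset.sum_comm]
  refine Finset.sum_congr rfl fun f _ => ?_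
  rw [Finset.sum_comm]
  refine Finset.sum_congr rfl fun c _ => ?_
  exact Finset.sum_ite_eq I _ _

open Classical in
lemma ncard_facesMeeting (I : Finset V) :
    (T.facesMeeting (I : Set V)).ncard
      = (Finset.univ.filter fun f => ∃ c, T.vert f c ∈ I).card := by
  rw [← Set.ncard_coe_finset]
  congr 1
  ext f
  simp [facesMeeting]

/-- A face meeting `I` contributes part of a full sum below `π`; `vert_surj` provides a face at
which the inequality is strict. -/
lemma sum_vertexCurvature_lt {k : V → ℝ} (hk : ∀ v, 0 < k v) {I : Finset V} (hI : I.Nonempty) :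
    ∑ v ∈ I, T.vertexCurvature k v < Real.pi * (T.facesMeeting (I : Set V)).ncard := by
  classical
  rw [sum_vertexCurvature, ncard_facesMeeting, mul_comm, ← nsmul_eq_mul, ← Finset.sum_const,
    Finset.sum_filter]
  have hlt : ∀ f, (∃ c, T.vert f c ∈ I) →
      ∑ c, (if T.vert f c ∈ I then T.cornerCurvature k f c else 0) < Real.pi := fun f _ => by
    refine lt_of_le_of_lt (Finset.sum_le_sum (g := T.cornerCurvature k f) fun c _ => ?_) ?_
    · split_ifs
      · exact le_rfl
      · exact (T.cornerCurvature_pos hk f c).le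
    · rw [T.sum_cornerCurvature k f 0]
      exact interstitialCurvature_lt_pi (hk _) (hk _) (hk _)
  obtain ⟨v, hv⟩ := hI
  obtain ⟨f, c, rfl⟩ := T.vert_surj v
  refine Finset.sum_lt_sum (fun f _ => ?_) ⟨f, Finset.mem_univ _, ?_⟩
  · split_ifs with h
    · exact (hlt f h).le
    · push Not at h
      exact (Finset.sum_eq_zero fun c _ => if_neg (h c)).le
  · rw [if_pos ⟨c, hv⟩]
    exact hlt f ⟨c, hv⟩

/-! ### Circle packing metrics with prescribed total geodesic curvatures -/

lemma le_sum_vertexCurvature {k : V → ℝ} {ε M B : ℝ} {I : Finset V}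
    (hε : 0 < ε) (hM : 0 < M) (hkε : ∀ v, ε ≤ k v) (hkM : ∀ v ∈ I, M ≤ k v)
    (hkB : ∀ v, v ∉ I → k v ≤ B) (hB : 0 < B) :
    (T.facesMeeting (I : Set V)).ncard
      * (interstitialCurvature M ε ε - 3 * arcCurvature B M ε)
      ≤ ∑ v ∈ I, T.vertexCurvature k v := by
  classical
  rw [sum_vertexCurvature, ncard_facesMeeting, ← nsmul_eq_mul, ← Finset.sum_const,
    Finset.sum_filter]
  refine Finset.sum_le_sum fun f _ => ?_
  split_ifs with h
  · obtain ⟨d, hd⟩ := h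
    exact T.le_sum_cornerCurvature hε hM hkε hkM hkB hB hd
  · refine Finset.sum_nonneg fun c _ => ?_
    split_ifs
    · exact (T.cornerCurvature_pos (fun v => hε.trans_le (hkε v)) f c).le
    · exact le_rfl

/-- The vectors `k ≥ ε` whose total geodesic curvatures are at most `Lhat`. -/
def subsolutions (Lhat : V → ℝ) (ε : ℝ) : Set (V → ℝ) :=
  {k | (∀ v, ε ≤ k v) ∧ ∀ v, T.vertexCurvature k v ≤ Lhat v}

variable {T}

/-- Compare, at each vertex, with the vector that attains the maximum there: passing to the supremum
only raises the neighbours. -/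
lemma sup_mem_subsolutions {Lhat : V → ℝ} {ε : ℝ} (hε : 0 < ε) {k k' : V → ℝ}
    (hk : k ∈ T.subsolutions Lhat ε) (hk' : k' ∈ T.subsolutions Lhat ε) :
    k ⊔ k' ∈ T.subsolutions Lhat ε := by
  refine ⟨fun v => le_sup_of_le_left (hk.1 v), fun v => ?_⟩
  rcases le_total (k v) (k' v) with h | h
  · refine (T.vertexCurvature_antitone (fun v => hε.trans_le (hk'.1 v)) le_sup_right ?_).trans
      (hk'.2 v)
    exact (sup_of_le_right h).symm
  · refine (T.vertexCurvature_antitone (fun v => hε.trans_le (hk.1 v)) le_sup_left ?_).trans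
      (hk.2 v)
    exact (sup_of_le_left h).symm

variable (T)

lemma exists_const_mem_subsolutions [Fintype V] {Lhat : V → ℝ} (hL : ∀ v, 0 < Lhat v) :
    ∃ ε, 0 < ε ∧ (fun _ => ε) ∈ T.subsolutions Lhat ε := by
  have h : Tendsto (fun x => Fintype.card F * (3 * arcCurvature x x x)) (𝓝[>] 0) (𝓝 0) := by
    simpa using (tendsto_arcCurvature_diag_zero.const_mul 3).const_mul (Fintype.card F : ℝ)
  have h2 : ∀ᶠ x in 𝓝[>] 0, ∀ v, Fintype.card F * (3 * arcCurvature x x x) < Lhat v :=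
    eventually_all.2 fun v => h.eventually (gt_mem_nhds (hL v))
  obtain ⟨ε, hε, hε0⟩ := (h2.and self_mem_nhdsWithin).exists
  exact ⟨ε, hε0, fun _ => le_rfl, fun v => (T.vertexCurvature_le_of
    (arcCurvature_pos hε0 hε0 hε0).le fun _ _ => le_rfl).trans (hε v).le⟩

/-- Let `I` be the set of vertices where subsolutions are unbounded. Maxima of subsolutions are
large on all of `I` at once and stay bounded off `I`, so in the limit `π |F_I| ≤ ∑ Lhat` over `I`,
against the hypothesis. -/
lemma bddAbove_subsolutions [Fintype V] {Lhat : V → ℝ} {ε : ℝ} (hε : 0 < ε)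
    (hε' : (fun _ => ε) ∈ T.subsolutions Lhat ε)
    (hI : ∀ I : Finset V, I.Nonempty →
      ∑ i ∈ I, Lhat i < Real.pi * (T.facesMeeting (I : Set V)).ncard) (v : V) :
    BddAbove ((fun k => k v) '' T.subsolutions Lhat ε) := by
  classical
  by_contra hv
  set I : Finset V := Finset.univ.filter fun v =>
    ¬ BddAbove ((fun k => k v) '' T.subsolutions Lhat ε) with hIdef
  have hvI : v ∈ I := by simp [hIdef, hv]
  have hbd : ∀ w, ∃ b, w ∉ I → ∀ k ∈ T.subsolutions Lhat ε, k w ≤ b := fun w => by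
    by_cases hw : w ∈ I
    · exact ⟨0, fun h => absurd hw h⟩
    · have : BddAbove ((fun k => k w) '' T.subsolutions Lhat ε) := by
        simpa [hIdef] using hw
      obtain ⟨b, hb⟩ := this
      exact ⟨b, fun _ k hk => hb ⟨k, hk, rfl⟩⟩
  choose b hb using hbd
  obtain ⟨B, hBb⟩ : ∃ B, ∀ w, b w ≤ B := by
    obtain ⟨B, hB⟩ := (Set.finite_range b).bddAbove
    exact ⟨B, fun w => hB ⟨w, rfl⟩⟩
  set B' := max B 1 with hB'
  have hB'0 : 0 < B' := lt_max_of_lt_right one_pos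
  have hlarge : ∀ M : ℝ, ∃ k ∈ T.subsolutions Lhat ε, ∀ w ∈ I, M ≤ k w := fun M => by
    have : ∀ w, ∃ k ∈ T.subsolutions Lhat ε, w ∈ I → M ≤ k w := fun w => by
      by_cases hw : w ∈ I
      · have : ¬ BddAbove ((fun k => k w) '' T.subsolutions Lhat ε) := by
          simpa [hIdef] using hw
        rw [not_bddAbove_iff] at this
        obtain ⟨_, ⟨k, hk, rfl⟩, hlt⟩ := this M
        exact ⟨k, hk, fun _ => hlt.le⟩
      · exact ⟨_, hε', fun h => absurd h hw⟩
    choose κ hκ hκM using this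
    refine ⟨I.sup' ⟨v, hvI⟩ κ, Finset.sup'_mem _ (fun _ hx _ hy => sup_mem_subsolutions hε hx hy)
      _ _ _ fun w _ => hκ w, fun w hw => (hκM w hw).trans ?_⟩
    exact Finset.le_sup' κ hw w
  have hlim : Tendsto (fun M => ((T.facesMeeting (I : Set V)).ncard : ℝ)
      * (interstitialCurvature M ε ε - 3 * arcCurvature B' M ε)) atTop
      (𝓝 ((T.facesMeeting (I : Set V)).ncard * (Real.pi - 3 * 0))) :=
    ((tendsto_interstitialCurvature_atTop hε hε).sub
      ((tendsto_arcCurvature_neighbour_atTop hB'0 hε).const_mul 3)).const_mul _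
  have hle := le_of_tendsto (b := ∑ i ∈ I, Lhat i) hlim (by
    filter_upwards [eventually_gt_atTop 0] with M hM
    obtain ⟨k, hk, hkM⟩ := hlarge M
    exact (T.le_sum_vertexCurvature hε hM hk.1 hkM
      (fun w hw => ((hb w hw k hk).trans (hBb w)).trans (le_max_left _ _)) hB'0).trans
      (Finset.sum_le_sum fun w _ => hk.2 w))
  have := hI I ⟨v, hvI⟩
  linarith

/-- Existence of a metric with prescribed total geodesic curvatures, by Perron's method. -/
theorem exists_vertexCurvature_eq [Fintype V] {Lhat : V → ℝ} (hL : ∀ v, 0 < Lhat v)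
    (hI : ∀ I : Finset V, I.Nonempty →
      ∑ i ∈ I, Lhat i < Real.pi * (T.facesMeeting (I : Set V)).ncard) :
    ∃ k : V → ℝ, (∀ v, 0 < k v) ∧ ∀ v, T.vertexCurvature k v = Lhat v := by
  classical
  obtain ⟨ε, hε, hε'⟩ := T.exists_const_mem_subsolutions hL
  have hbdd := T.bddAbove_subsolutions hε hε' hI
  set P := T.subsolutions Lhat ε with hP
  set U : V → ℝ := fun v => sSup ((fun k => k v) '' P) with hU
  have hle : ∀ k ∈ P, k ≤ U := fun k hk v => le_csSup (hbdd v) ⟨k, hk, rfl⟩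
  have hUε : ∀ v, ε ≤ U v := fun v => hle _ hε' v
  have hU0 : ∀ v, 0 < U v := fun v => hε.trans_le (hUε v)
  have hcont : ∀ v, ContinuousAt (fun s => T.vertexCurvature (Function.update U v s) v) (U v) :=
    fun v => by
      have h1 : ContinuousAt (fun k => T.vertexCurvature k v) (Function.update U v (U v)) := by
        rw [Function.update_eq_self]
        exact (T.contDiffAt_vertexCurvature hU0 v).continuousAt
      exact ContinuousAt.comp (f := fun s => Function.update U v s) h1
        (continuous_const.update v continuous_id).continuousAt
  -- Take subsolutions whose values at `v` tend to `U v`. Raising their other coordinates to those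
  -- of `U` preserves the inequality at `v`, and only continuity in the single coordinate `v` is
  -- needed.
  have hUP : ∀ v, T.vertexCurvature U v ≤ Lhat v := fun v => by
    obtain ⟨s, -, hs, hsP⟩ := exists_seq_tendsto_sSup (S := (fun k : V → ℝ => k v) '' P)
      ⟨_, _, hε', rfl⟩ (hbdd v)
    have h1 := (hcont v).tendsto.comp hs
    simp only [Function.update_eq_self] at h1
    refine le_of_tendsto h1 (Eventually.of_forall fun n => ?_)
    obtain ⟨k, hk, hkn⟩ := hsP n
    refine (T.vertexCurvature_antitone (k := k) (fun v => hε.trans_le (hk.1 v)) ?_ ?_).trans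
      (hk.2 v)
    · intro w
      by_cases hw : w = v
      · subst hw; simp [← hkn]
      · simpa [Function.update_of_ne hw] using hle k hk w
    · simpa using hkn
  refine ⟨U, hU0, fun v => (hUP v).antisymm (le_of_not_gt fun hlt => ?_)⟩
  -- If the inequality were strict at `v`, a slight increase of `U v` would keep it there and lower
  -- the other totals, giving a subsolution above the supremum.
  have h1 : ∀ᶠ s in 𝓝 (U v), T.vertexCurvature (Function.update U v s) v < Lhat v :=
    (hcont v).tendsto.eventually (gt_mem_nhds (by simpa using hlt))
  obtain ⟨s, hs, hsU⟩ := ((h1.filter_mono nhdsWithin_le_nhds).and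
    (self_mem_nhdsWithin (s := Set.Ioi (U v)))).exists
  have hsU' : U v < s := hsU
  have hUs : U ≤ Function.update U v s := by
    rw [le_update_iff]; exact ⟨hsU'.le, fun _ _ => le_rfl⟩
  have hmem : Function.update U v s ∈ P := by
    refine ⟨fun w => (hUε w).trans (hUs w), fun w => ?_⟩
    by_cases hw : w = v
    · subst hw; exact hs.le
    · exact (T.vertexCurvature_antitone hU0 hUs (by rw [Function.update_of_ne hw])).trans (hUP w)
  have := hle _ hmem v
  rw [Function.update_self] at this
  linarith

/-- A maximum principle: `k ≤ k'` if at every vertex where `k / k'` is maximal and larger than `1`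
the curvature of `k` is at most that of `k'`. -/
lemma le_of_vertexCurvature_le [Fintype V] {k k' : V → ℝ} (hk : ∀ v, 0 < k v)
    (hk' : ∀ v, 0 < k' v) (h : ∀ v, T.vertexCurvature k v ≤ T.vertexCurvature k' v) :
    k ≤ k' := by
  intro w
  by_contra! hw
  obtain ⟨v, -, hv⟩ := Finset.exists_max_image Finset.univ (fun v => k v / k' v) ⟨w, by simp⟩
  have hv' : ∀ u, k u ≤ k v / k' v * k' u := fun u =>
    (div_le_iff₀ (hk' u)).1 (hv u (Finset.mem_univ u))
  have ht : 1 < k v / k' v := ((one_lt_div (hk' w)).2 hw).trans_le (hv w (Finset.mem_univ w))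
  -- The scaled `k'` lies above `k` and touches it at `v`, so `L_v(k)` is at least its total at `v`,
  -- which exceeds `L_v(k')`.
  have h1 := T.vertexCurvature_scale_lt (v := v) hk' ht
  have h2 := T.vertexCurvature_antitone (v := v) hk hv' (by
    rw [div_mul_cancel₀ _ (hk' v).ne'])
  linarith [h v]

lemma eq_of_vertexCurvature_eq [Fintype V] {k k' : V → ℝ} (hk : ∀ v, 0 < k v)
    (hk' : ∀ v, 0 < k' v) (h : ∀ v, T.vertexCurvature k v = T.vertexCurvature k' v) : k = k' :=
  le_antisymm (T.le_of_vertexCurvature_le hk hk' fun v => (h v).le)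
    (T.le_of_vertexCurvature_le hk' hk fun v => (h v).ge)

end

end TriangulatedSurface

/-! ### Differential inequalities for finite families of functions -/

/-- If a finite family of functions starts below zero and every member that touches zero from below
together with the others has negative derivative, the family stays below zero. -/
lemma neg_of_hasDerivWithinAt_neg {ι : Type*} [Finite ι] {g g' : ι → ℝ → ℝ} {b : ℝ}
    (hg : ∀ i, ∀ t ∈ Set.Ico 0 b, HasDerivWithinAt (g i) (g' i t) (Set.Ico 0 b) t)
    (h0 : ∀ i, g i 0 < 0)
    (h : ∀ t ∈ Set.Ico 0 b, (∀ j, g j t ≤ 0) → ∀ i, g i t = 0 → g' i t < 0) :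
    ∀ t ∈ Set.Ico 0 b, ∀ i, g i t < 0 := by
  intro t₀ ht₀ i₀
  by_contra! hi₀
  have hsub : Set.Icc 0 t₀ ⊆ Set.Ico 0 b := fun s hs => ⟨hs.1, hs.2.trans_lt ht₀.2⟩
  have hcont : ∀ i, ContinuousOn (g i) (Set.Ico 0 b) := fun i t ht => (hg i t ht).continuousWithinAt
  set S : Set ℝ := ⋃ i, Set.Icc 0 t₀ ∩ g i ⁻¹' Set.Ici 0 with hS
  have hSc : IsCompact S := isCompact_iUnion fun i =>
    isCompact_Icc.of_isClosed_subset (((hcont i).mono hsub).preimage_isClosed_of_isClosed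
      isClosed_Icc isClosed_Ici) Set.inter_subset_left
  have hSne : S.Nonempty := ⟨t₀, Set.mem_iUnion.2 ⟨i₀, ⟨ht₀.1, le_rfl⟩, hi₀⟩⟩
  set τ := sInf S with hτ
  obtain ⟨i, hτi, hgi⟩ := Set.mem_iUnion.1 (hSc.sInf_mem hSne)
  have hgi' : 0 ≤ g i τ := hgi
  have hτb := hsub hτi
  have hτ0 : 0 < τ := by
    rcases hτi.1.eq_or_lt with h1 | h1
    · rw [hτ, ← h1] at hgi'
      exact absurd hgi' (not_le.2 (h0 i))
    · exact h1
  have hbelow : ∀ s ∈ Set.Ioo 0 τ, ∀ j, g j s < 0 := fun s hs j => by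
    by_contra! hj
    exact absurd (csInf_le hSc.bddBelow (Set.mem_iUnion.2
      ⟨j, ⟨hs.1.le, hs.2.le.trans hτi.2⟩, hj⟩)) (not_le.2 hs.2)
  have hss : Set.Ioo 0 τ ⊆ Set.Ico 0 b := fun s hs => ⟨hs.1.le, hs.2.trans hτb.2⟩
  have hne : (𝓝[Set.Ioo 0 τ] τ).NeBot := by
    rw [nhdsWithin_Ioo_eq_nhdsLT hτ0]; infer_instance
  have hle : ∀ j, g j τ ≤ 0 := fun j => by
    refine le_of_tendsto ((hcont j τ hτb).mono hss) ?_
    filter_upwards [self_mem_nhdsWithin] with s hs using (hbelow s hs j).le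
  have heq : g i τ = 0 := le_antisymm (hle i) hgi'
  have hd := (hg i τ hτb).mono hss
  -- At the first contact time `τ`, left difference quotients are positive, since `g i` is negative
  -- before `τ` and zero at `τ`.
  rw [hasDerivWithinAt_iff_tendsto_slope' (by simp)] at hd
  obtain ⟨s, hs1, hs2⟩ := ((hd.eventually (gt_mem_nhds (h τ hτb hle i heq))).and
    self_mem_nhdsWithin).exists
  rw [slope_def_field, heq, sub_zero, div_neg_iff] at hs1
  have := hbelow s hs2 i
  have := hs2.2
  rcases hs1 with h1 | h1 <;> linarith [h1.1, h1.2]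

/-- By the mean value theorem `f'` takes the value `f (n + 1) - f n` somewhere after `n`, and these
differences tend to `0`. -/
lemma eq_zero_of_tendsto_of_tendsto_deriv {f f' : ℝ → ℝ} {a c : ℝ}
    (hf : ∀ t ∈ Set.Ici (0 : ℝ), HasDerivWithinAt f (f' t) (Set.Ici 0) t)
    (hfa : Tendsto f atTop (𝓝 a)) (hfc : Tendsto f' atTop (𝓝 c)) : c = 0 := by
  have h : ∀ n : ℕ, ∃ ξ : ℝ, (n : ℝ) < ξ ∧ f' ξ = f (n + 1) - f n := fun n => by
    have hn : (0 : ℝ) ≤ n := n.cast_nonneg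
    obtain ⟨ξ, hξ, h⟩ := exists_hasDerivAt_eq_slope f f' (lt_add_one (n : ℝ))
      (fun t ht => ((hf t (hn.trans ht.1)).continuousWithinAt).mono
        fun s hs => hn.trans hs.1)
      (fun t ht => (hf t (hn.trans ht.1.le)).hasDerivAt (Ici_mem_nhds (hn.trans_lt ht.1)))
    exact ⟨ξ, hξ.1, by rw [h, add_sub_cancel_left, div_one]⟩
  choose ξ hξ hfξ using h
  have h1 : Tendsto (fun n => f' (ξ n)) atTop (𝓝 c) :=
    hfc.comp (tendsto_atTop_mono (fun n => (hξ n).le) tendsto_natCast_atTop_atTop)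
  have h2 : Tendsto (fun n : ℕ => f ((n : ℝ) + 1) - f n) atTop (𝓝 (a - a)) :=
    (hfa.comp (tendsto_atTop_add_const_right _ 1 tendsto_natCast_atTop_atTop)).sub
      (hfa.comp tendsto_natCast_atTop_atTop)
  rw [sub_self] at h2
  exact tendsto_nhds_unique (h1.congr hfξ) h2

/-! ### Autonomous systems with bounded `C¹` right-hand side -/

/-- At speed at most `M` a solution stays in the ball of radius `M * b` up to time `b`; `X` is
Lipschitz on this compact ball, so one application of Picard–Lindelöf covers the interval. -/
lemma exists_hasDerivWithinAt_Icc_of_bounded {E : Type*} [NormedAddCommGroup E] [NormedSpace ℝ E]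
    [FiniteDimensional ℝ E] {X : E → E} (hX : ContDiff ℝ 1 X) {M : ℝ} (hM : ∀ u, ‖X u‖ ≤ M)
    (u₀ : E) {b : ℝ} (hb : 0 ≤ b) :
    ∃ α : ℝ → E, α 0 = u₀ ∧
      ∀ t ∈ Set.Icc 0 b, HasDerivWithinAt α (X (α t)) (Set.Icc 0 b) t := by
  have hM0 : 0 ≤ M := (norm_nonneg _).trans (hM u₀)
  have : ProperSpace E := FiniteDimensional.proper ℝ E
  obtain ⟨K, hK⟩ := (hX.locallyLipschitz.locallyLipschitzOn
    (s := Metric.closedBall u₀ (M * b))).exists_lipschitzOnWith_of_compact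
      (isCompact_closedBall _ _)
  have hP : IsPicardLindelof (fun _ => X) (⟨0, le_rfl, hb⟩ : Set.Icc 0 b) u₀
      ⟨M * b, mul_nonneg hM0 hb⟩ 0 ⟨M, hM0⟩ K :=
    { lipschitzOnWith := fun _ _ => hK
      continuousOn := fun _ _ => continuousOn_const
      norm_le := fun _ _ u _ => hM u
      mul_max_le := by
        simp only [sub_zero, sub_self, max_eq_left hb, NNReal.coe_zero]
        exact le_rfl }
  exact hP.exists_eq_forall_mem_Icc_hasDerivWithinAt₀

namespace TriangulatedSurface

variable {V F : Type*} (T : TriangulatedSurface V F) [Fintype F]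

/-! ### The flow in logarithmic coordinates -/

/-- `u` solves `duᵢ/dt = -(Lᵢ(exp u) - L̂ᵢ)` on the time interval `J`. -/
def IsLogFlowSolutionOn (Lhat : V → ℝ) (J : Set ℝ) (u : ℝ → V → ℝ) : Prop :=
  ∀ t ∈ J, ∀ i, HasDerivWithinAt (fun s => u s i)
    (Lhat i - T.vertexCurvature (fun v => Real.exp (u t v)) i) J t

variable {T}

lemma IsFlowSolutionOn.log {Lhat : V → ℝ} {J : Set ℝ} {k : ℝ → V → ℝ}
    (hk : T.IsFlowSolutionOn Lhat J k) :
    T.IsLogFlowSolutionOn Lhat J fun t v => Real.log (k t v) := by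
  intro t ht i
  obtain ⟨hpos, hd⟩ := hk t ht i
  have hexp : (fun v => Real.exp (Real.log (k t v))) = k t :=
    funext fun v => Real.exp_log (hk t ht v).1
  refine (hd.log hpos.ne').congr_deriv ?_
  rw [T.totalGeodesicCurvature_eq fun v => (hk t ht v).1, hexp]
  field_simp
  ring

lemma IsLogFlowSolutionOn.exp {Lhat : V → ℝ} {J : Set ℝ} {u : ℝ → V → ℝ}
    (hu : T.IsLogFlowSolutionOn Lhat J u) :
    T.IsFlowSolutionOn Lhat J fun t v => Real.exp (u t v) := by
  refine fun t ht i => ⟨Real.exp_pos _, (hu t ht i).exp.congr_deriv ?_⟩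
  rw [T.totalGeodesicCurvature_eq fun v => Real.exp_pos _]
  ring

lemma IsLogFlowSolutionOn.mono {Lhat : V → ℝ} {J J' : Set ℝ} {u : ℝ → V → ℝ}
    (hu : T.IsLogFlowSolutionOn Lhat J u) (h : J' ⊆ J) : T.IsLogFlowSolutionOn Lhat J' u :=
  fun t ht i => (hu t (h ht) i).mono h

variable (T)

/-- The contact step of the comparison arguments: a uniform shift of `w` is a scaling of curvatures.
-/
lemma vertexCurvature_exp_mono_of_le_add {u w : V → ℝ} {N : ℝ} {v : V} (h : ∀ i, u i ≤ w i + N)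
    (hv : u v = w v + N) :
    T.vertexCurvature (fun i => Real.exp N * Real.exp (w i)) v
      ≤ T.vertexCurvature (fun i => Real.exp (u i)) v := by
  refine T.vertexCurvature_antitone (fun _ => Real.exp_pos _) (fun i => ?_) ?_
  · rw [← Real.exp_add, Real.exp_le_exp, add_comm]; exact h i
  · rw [← Real.exp_add, hv, add_comm]

lemma vertexCurvature_le_of_one_le {k : V → ℝ} {v : V} (hk : ∀ v, 0 < k v) {t : ℝ} (ht : 1 ≤ t) :
    T.vertexCurvature k v ≤ T.vertexCurvature (fun v => t * k v) v := by
  rcases ht.eq_or_lt with rfl | ht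
  · simp
  · exact (T.vertexCurvature_scale_lt hk ht).le

variable {T}

/-- The comparison principle for the flow. -/
lemma IsLogFlowSolutionOn.le [Finite V] {Lhat : V → ℝ} {b : ℝ} {u w : ℝ → V → ℝ}
    (hu : T.IsLogFlowSolutionOn Lhat (Set.Ico 0 b) u)
    (hw : T.IsLogFlowSolutionOn Lhat (Set.Ico 0 b) w) (h0 : u 0 ≤ w 0) :
    ∀ t ∈ Set.Ico 0 b, u t ≤ w t := by
  intro t ht i
  refine le_of_forall_pos_le_add fun e he => ?_
  have ht1 : 0 < 1 + t := by linarith [ht.1]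
  -- The shift `e (1 + s) / (1 + t)` grows with `s`, which gives the strict sign at a contact, and
  -- equals `e` at `s = t`.
  have key := neg_of_hasDerivWithinAt_neg (b := b)
    (g := fun v s => u s v - w s v - e / (1 + t) * (1 + s))
    (g' := fun v s => (Lhat v - T.vertexCurvature (fun i => Real.exp (u s i)) v)
      - (Lhat v - T.vertexCurvature (fun i => Real.exp (w s i)) v) - e / (1 + t))
    (fun v s hs => ((hu s hs v).sub (hw s hs v)).sub (by
      simpa using (((hasDerivWithinAt_id s (Set.Ico 0 b)).const_add 1).const_mul (e / (1 + t)))))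
    (fun v => by
      have := h0 v
      have : 0 < e / (1 + t) := by positivity
      simp only
      linarith)
    (fun s hs hle v hv => by
      have he' : 0 < e / (1 + t) := by positivity
      have hN : 0 ≤ e / (1 + t) * (1 + s) := mul_nonneg he'.le (by linarith [hs.1])
      have h1 := T.vertexCurvature_exp_mono_of_le_add (u := u s) (w := w s)
        (N := e / (1 + t) * (1 + s)) (v := v) (fun i => by linarith [hle i]) (by linarith)
      have h2 := T.vertexCurvature_le_of_one_le (v := v) (fun i => Real.exp_pos (w s i))
        (Real.one_le_exp hN)
      linarith) t ht i
  have : e / (1 + t) * (1 + t) = e := div_mul_cancel₀ _ ht1.ne'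
  simp only [this] at key
  linarith

lemma IsLogFlowSolutionOn.eqOn [Finite V] {Lhat : V → ℝ} {b : ℝ} {u w : ℝ → V → ℝ}
    (hu : T.IsLogFlowSolutionOn Lhat (Set.Ico 0 b) u)
    (hw : T.IsLogFlowSolutionOn Lhat (Set.Ico 0 b) w) (h0 : u 0 = w 0) :
    Set.EqOn u w (Set.Ico 0 b) :=
  fun t ht => le_antisymm (hu.le hw h0.le t ht) (hw.le hu h0.ge t ht)

variable (T)

lemma exists_isLogFlowSolutionOn_Icc [Fintype V] (Lhat u₀ : V → ℝ) {b : ℝ} (hb : 0 ≤ b) :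
    ∃ u : ℝ → V → ℝ, u 0 = u₀ ∧ T.IsLogFlowSolutionOn Lhat (Set.Icc 0 b) u := by
  have hX : ContDiff ℝ 1 fun (u : V → ℝ) i =>
      Lhat i - T.vertexCurvature (fun v => Real.exp (u v)) i := by
    rw [contDiff_pi]
    intro i
    refine contDiff_const.sub (contDiff_iff_contDiffAt.2 fun u => ?_)
    exact ContDiffAt.comp (g := fun k => T.vertexCurvature k i) u
      (T.contDiffAt_vertexCurvature (fun v => Real.exp_pos (u v)) i) (by fun_prop)
  -- Each arc is below `π`, so the field is bounded and no blow-up can occur.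
  have hM : ∀ u : V → ℝ, ‖fun i => Lhat i - T.vertexCurvature (fun v => Real.exp (u v)) i‖
      ≤ ‖Lhat‖ + Fintype.card F * (3 * Real.pi) := fun u => by
    have hpi := Real.pi_pos
    rw [pi_norm_le_iff_of_nonneg (by positivity)]
    intro i
    refine (norm_sub_le _ _).trans (add_le_add (norm_le_pi_norm Lhat i) ?_)
    have hu := fun v => Real.exp_pos (u v)
    rw [Real.norm_of_nonneg (T.vertexCurvature_pos hu i).le]
    exact T.vertexCurvature_le_of hpi.le fun f c => (arcCurvature_lt_pi (hu _) (hu _) (hu _)).le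
  obtain ⟨u, hu0, hu⟩ := exists_hasDerivWithinAt_Icc_of_bounded hX hM u₀ hb
  exact ⟨u, hu0, fun t ht i => hasDerivWithinAt_pi.1 (hu t ht) i⟩

/-- Long-time existence. -/
theorem exists_isLogFlowSolutionOn_Ici [Fintype V] (Lhat u₀ : V → ℝ) :
    ∃ u : ℝ → V → ℝ, u 0 = u₀ ∧ T.IsLogFlowSolutionOn Lhat (Set.Ici 0) u := by
  choose α hα0 hα using fun n : ℕ => T.exists_isLogFlowSolutionOn_Icc Lhat u₀ n.cast_nonneg
  have hsub : ∀ {m n : ℕ}, m ≤ n → Set.Ico (0 : ℝ) m ⊆ Set.Icc 0 n := fun h s hs =>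
    ⟨hs.1, hs.2.le.trans (Nat.cast_le.2 h)⟩
  have hagree : ∀ {m n : ℕ}, m ≤ n → Set.EqOn (α m) (α n) (Set.Ico 0 m) := fun {m n} h =>
    ((hα m).mono (hsub le_rfl)).eqOn ((hα n).mono (hsub h)) (by rw [hα0, hα0])
  -- The index `⌊s⌋₊ + 1` strictly exceeds `s`, as the half-open intervals of agreement require.
  have hglue : ∀ n : ℕ, Set.EqOn (fun s => α (⌊s⌋₊ + 1) s) (α n) (Set.Ico 0 n) := fun n s hs => by
    have hs' : s ∈ Set.Ico (0 : ℝ) (⌊s⌋₊ + 1 : ℕ) := ⟨hs.1, by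
      push_cast; exact Nat.lt_floor_add_one s⟩
    exact hagree (Nat.succ_le_iff.2 ((Nat.floor_lt hs.1).2 hs.2)) hs'
  refine ⟨fun s => α (⌊s⌋₊ + 1) s, by simpa using hα0 1, fun t ht i => ?_⟩
  obtain ⟨n, hn⟩ := exists_nat_gt t
  have htn : t ∈ Set.Ico (0 : ℝ) n := ⟨ht, hn⟩
  have h1 := (hα n).mono (hsub le_rfl) t htn i
  have h2 : HasDerivWithinAt (fun s => α (⌊s⌋₊ + 1) s i) _ (Set.Ico 0 n) t :=
    h1.congr (fun s hs => congrFun (hglue n hs) i) (congrFun (hglue n htn) i)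
  have h3 := hglue n htn
  simp only at h3 ⊢
  rw [h3]
  exact h2.mono_of_mem_nhdsWithin (by
    rw [← Set.Ici_inter_Iio]
    exact inter_mem_nhdsWithin _ (Iio_mem_nhds hn))

/-! ### Exponential convergence -/

/-- The scaling derivative is positive and continuous; `m` is its minimum on the compact interval.
-/
lemma exists_mul_sub_le_arcCurvature {x a b p q : ℝ} (hx : 0 < x) (ha : 0 < a) (hb : 0 < b)
    (hp : 0 < p) (hpq : p ≤ q) :
    ∃ m, 0 < m ∧ ∀ s ∈ Set.Icc p q, ∀ t ∈ Set.Icc p q, s ≤ t → m * (t - s)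
      ≤ arcCurvature (t * x) (t * a) (t * b) - arcCurvature (s * x) (s * a) (s * b) := by
  have hpos : ∀ t ∈ Set.Icc p q, 0 < t := fun t ht => hp.trans_le ht.1
  have hc : ContinuousOn (fun t => x * interstitialDeriv (t * x) (t * a) (t * b))
      (Set.Icc p q) := fun t ht => by
    have ht := hpos t ht
    have h1 := continuousAt_interstitialDeriv (p := (t * x, t * a, t * b)) (mul_pos ht hx)
      (mul_pos ht ha) (mul_pos ht hb)
    have h2 : ContinuousAt (fun t : ℝ => (t * x, t * a, t * b)) t := by fun_prop
    exact (continuousAt_const.mul (ContinuousAt.comp (f := fun t : ℝ => (t * x, t * a, t * b))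
      h1 h2)).continuousWithinAt
  obtain ⟨r, hr, hmin⟩ := isCompact_Icc.exists_isMinOn (Set.nonempty_Icc.2 hpq) hc
  have hr0 := hpos r hr
  refine ⟨_, mul_pos hx (interstitialDeriv_pos (mul_pos hr0 hx) (mul_pos hr0 ha)
    (mul_pos hr0 hb)), fun s hs t ht hst => ?_⟩
  refine (convex_Icc p q).mul_sub_le_image_sub_of_le_deriv
    (f := fun t => arcCurvature (t * x) (t * a) (t * b)) (fun t ht =>
      (hasDerivAt_arcCurvature_scale hx ha hb (hpos t ht)).continuousAt.continuousWithinAt)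
    (fun t ht => (hasDerivAt_arcCurvature_scale hx ha hb
      (hpos t (interior_subset ht))).differentiableAt.differentiableWithinAt)
    (fun t ht => ?_) s hs t ht hst
  rw [(hasDerivAt_arcCurvature_scale hx ha hb (hpos t (interior_subset ht))).deriv]
  exact hmin (interior_subset ht)

lemma vertexCurvature_add_le_of {k k' : V → ℝ} {e : ℝ} {f₀ : F} {c₀ : Fin 3}
    (h : ∀ f c, T.cornerCurvature k f c ≤ T.cornerCurvature k' f c)
    (h₀ : T.cornerCurvature k f₀ c₀ + e ≤ T.cornerCurvature k' f₀ c₀) :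
    T.vertexCurvature k (T.vert f₀ c₀) + e ≤ T.vertexCurvature k' (T.vert f₀ c₀) := by
  classical
  -- The gain is written as a sum concentrated at one corner, so that the comparison can be made
  -- termwise.
  have he : e = ∑ f, ∑ c, if f = f₀ then (if c = c₀ then e else 0) else 0 := by
    simp
  conv_lhs => rw [he]
  unfold vertexCurvature
  rw [← Finset.sum_add_distrib]
  refine Finset.sum_le_sum fun f _ => ?_
  rw [← Finset.sum_add_distrib]
  refine Finset.sum_le_sum fun c _ => ?_
  by_cases hf : f = f₀ <;> by_cases hc : c = c₀
  · subst hf hc; simpa using h₀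
  · rw [if_pos hf, if_neg hc, add_zero]
    split_ifs
    exacts [h f c, le_rfl]
  · rw [if_neg hf, add_zero]
    split_ifs
    exacts [h f c, le_rfl]
  · rw [if_neg hf, add_zero]
    split_ifs
    exacts [h f c, le_rfl]

lemma exists_mul_sub_le_vertexCurvature [Finite V] {k : V → ℝ} (hk : ∀ v, 0 < k v) {p q : ℝ}
    (hp : 0 < p) (hpq : p ≤ q) :
    ∃ m, 0 < m ∧ ∀ v, ∀ s ∈ Set.Icc p q, ∀ t ∈ Set.Icc p q, s ≤ t → m * (t - s)
      ≤ T.vertexCurvature (fun i => t * k i) v - T.vertexCurvature (fun i => s * k i) v := by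
  have h : ∀ v, ∃ m, 0 < m ∧ ∀ s ∈ Set.Icc p q, ∀ t ∈ Set.Icc p q, s ≤ t → m * (t - s)
      ≤ T.vertexCurvature (fun i => t * k i) v - T.vertexCurvature (fun i => s * k i) v := by
    intro v
    obtain ⟨f, c, rfl⟩ := T.vert_surj v
    obtain ⟨m, hm, h⟩ := exists_mul_sub_le_arcCurvature (hk (T.vert f c))
      (hk (T.vert f (c + 1))) (hk (T.vert f (c + 2))) hp hpq
    refine ⟨m, hm, fun s hs t ht hst => ?_⟩
    have := T.vertexCurvature_add_le_of (k := fun i => s * k i) (k' := fun i => t * k i)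
      (e := m * (t - s)) (f₀ := f) (c₀ := c)
      (fun f c => (strictMonoOn_arcCurvature_scale (hk (T.vert f c))
        (hk (T.vert f (c + 1))) (hk (T.vert f (c + 2)))).monotoneOn
          (Set.mem_Ioi.2 (hp.trans_le hs.1)) (Set.mem_Ioi.2 (hp.trans_le ht.1)) hst)
      (by
        have := h s hs t ht hst
        unfold cornerCurvature
        linarith)
    linarith
  choose m hm h using h
  obtain ⟨f⟩ := T.face_nonempty
  have : Nonempty V := ⟨T.vert f 0⟩
  obtain ⟨v₀, hv₀⟩ := Finite.exists_min m
  exact ⟨m v₀, hm v₀, fun v s hs t ht hst =>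
    (mul_le_mul_of_nonneg_right (hv₀ v) (sub_nonneg.2 hst)).trans (h v s hs t ht hst)⟩

variable {T}

/-- Solutions of the flow converge exponentially fast to a fixed point. -/
theorem IsLogFlowSolutionOn.exists_abs_sub_le [Fintype V] {Lhat : V → ℝ} {u : ℝ → V → ℝ}
    (hu : T.IsLogFlowSolutionOn Lhat (Set.Ici 0) u) {w : V → ℝ}
    (hw : ∀ v, T.vertexCurvature (fun i => Real.exp (w i)) v = Lhat v) :
    ∃ N δ : ℝ, 0 < N ∧ 0 < δ ∧
      ∀ t, 0 ≤ t → ∀ i, |u t i - w i| ≤ N * Real.exp (-(δ * t)) := by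
  -- The `1` makes the initial inequalities strict.
  set N : ℝ := ‖u 0 - w‖ + 1 with hN
  have hN0 : 0 < N := by positivity
  have hinit : ∀ i, |u 0 i - w i| < N := fun i =>
    (norm_le_pi_norm (u 0 - w) i).trans_lt (lt_add_one _)
  obtain ⟨m, hm, hmL⟩ := T.exists_mul_sub_le_vertexCurvature (fun i => Real.exp_pos (w i))
    (Real.exp_pos (-N)) (Real.exp_le_exp.2 (by linarith : -N ≤ N))
  -- For `0 < r ≤ N` both `e^r - 1` and `1 - e^{-r}` are at least `r e^{-N}`, so scaling `exp w` by
  -- `e^{±r}` moves each total by at least `m e^{-N} r`; the half makes the barriers strict.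
  set δ := m * Real.exp (-N) / 2 with hδ
  have hδ0 : 0 < δ := by positivity
  set φ : ℝ → ℝ := fun t => N * Real.exp (-(δ * t)) with hφ
  have hφ' : ∀ t s, HasDerivWithinAt φ (-(δ * φ t)) s t := fun t s => by
    have h1 : HasDerivAt (fun t : ℝ => -(δ * t)) (-δ) t := by
      exact ((hasDerivAt_id t).const_mul δ).neg.congr_deriv (by simp)
    refine (h1.exp.const_mul N).hasDerivWithinAt.congr_deriv ?_
    simp only [hφ]; ring
  have hφ0 : ∀ t, 0 < φ t := fun t => by positivity
  have hφN : ∀ t, 0 ≤ t → φ t ≤ N := fun t ht =>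
    mul_le_of_le_one_right hN0.le (Real.exp_le_one_iff.2 (by nlinarith))
  have hmem : ∀ r, |r| ≤ N → Real.exp r ∈ Set.Icc (Real.exp (-N)) (Real.exp N) := fun r hr =>
    ⟨Real.exp_le_exp.2 (abs_le.1 hr).1, Real.exp_le_exp.2 (abs_le.1 hr).2⟩
  have hmem1 : (1 : ℝ) ∈ Set.Icc (Real.exp (-N)) (Real.exp N) := by
    simpa using hmem 0 (by simpa using hN0.le)
  have hup : ∀ r, 0 < r → r ≤ N → ∀ v, δ * r
      < T.vertexCurvature (fun i => Real.exp r * Real.exp (w i)) v - Lhat v := fun r hr hrN v => by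
    have h1 := hmL v 1 hmem1 _ (hmem r (by rwa [abs_of_pos hr])) (Real.one_le_exp hr.le)
    simp only [one_mul] at h1
    rw [hw] at h1
    have h2 : r ≤ Real.exp r - 1 := by linarith [Real.add_one_le_exp r]
    have h3 : Real.exp (-N) ≤ 1 := Real.exp_le_one_iff.2 (by linarith)
    have h4 : δ < m := by rw [hδ]; nlinarith
    nlinarith
  have hdown : ∀ r, 0 < r → r ≤ N → ∀ v, δ * r
      < Lhat v - T.vertexCurvature (fun i => Real.exp (-r) * Real.exp (w i)) v :=
    fun r hr hrN v => by
      have h1 := hmL v _ (hmem (-r) (by rwa [abs_neg, abs_of_pos hr])) 1 hmem1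
        (Real.exp_le_one_iff.2 (by linarith))
      simp only [one_mul] at h1
      rw [hw] at h1
      have h2 : r * Real.exp (-r) ≤ 1 - Real.exp (-r) := by
        have := mul_le_mul_of_nonneg_right (Real.add_one_le_exp r) (Real.exp_pos (-r)).le
        rw [← Real.exp_add, add_neg_cancel, Real.exp_zero] at this
        linarith
      have h3 : r * Real.exp (-N) ≤ r * Real.exp (-r) :=
        mul_le_mul_of_nonneg_left (Real.exp_le_exp.2 (by linarith)) hr.le
      have h4 : m * (r * Real.exp (-N)) ≤ m * (1 - Real.exp (-r)) :=
        mul_le_mul_of_nonneg_left (h3.trans h2) hm.le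
      have h5 : 0 < m * (r * Real.exp (-N)) := by positivity
      have h6 : δ * r = m * (r * Real.exp (-N)) / 2 := by rw [hδ]; ring
      linarith
  refine ⟨N, δ, hN0, hδ0, fun t ht i => ?_⟩
  have huI : T.IsLogFlowSolutionOn Lhat (Set.Ico 0 (t + 1)) u := hu.mono fun s hs => hs.1
  have htI : t ∈ Set.Ico 0 (t + 1) := ⟨ht, lt_add_one t⟩
  have hφz : φ 0 = N := by simp [hφ]
  -- Upper barrier `w + φ`: at a contact `u` moves at a rate below `-δ φ`, which is `φ'`. The lower
  -- barrier `w - φ` is symmetric.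
  have hA := neg_of_hasDerivWithinAt_neg (b := t + 1) (g := fun v s => u s v - w v - φ s)
    (fun v s hs => ((huI s hs v).sub_const (w v)).sub (hφ' s _))
    (fun v => by
      have := (abs_lt.1 (hinit v)).2
      simp only [hφz]; linarith)
    (fun s hs hle v hv => by
      have h1 := T.vertexCurvature_exp_mono_of_le_add (u := u s) (w := w) (N := φ s) (v := v)
        (fun i => by linarith [hle i]) (by linarith)
      have h2 := hup (φ s) (hφ0 s) (hφN s hs.1) v
      linarith) t htI i
  have hB := neg_of_hasDerivWithinAt_neg (b := t + 1) (g := fun v s => w v - u s v - φ s)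
    (fun v s hs => ((huI s hs v).const_sub (w v)).sub (hφ' s _))
    (fun v => by
      have := (abs_lt.1 (hinit v)).1
      simp only [hφz]; linarith)
    (fun s hs hle v hv => by
      have h1 := T.vertexCurvature_exp_mono_of_le_add (u := w) (w := u s) (N := φ s) (v := v)
        (fun i => by linarith [hle i]) (by linarith)
      have h1' : T.vertexCurvature (fun i => Real.exp (u s i)) v
          ≤ T.vertexCurvature (fun i => Real.exp (-(φ s)) * Real.exp (w i)) v := by
        refine T.vertexCurvature_antitone (fun i => by positivity) (fun i => ?_) ?_
        · rw [← Real.exp_add, Real.exp_le_exp]; linarith [hle i]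
        · rw [← Real.exp_add]; congr 1; linarith
      have h2 := hdown (φ s) (hφ0 s) (hφN s hs.1) v
      linarith) t htI i
  rw [abs_le]
  constructor <;> linarith

/-- The limit of a solution of the flow is a fixed point. -/
lemma IsFlowSolutionOn.vertexCurvature_eq_of_tendsto [Fintype V] {Lhat : V → ℝ} {k : ℝ → V → ℝ}
    (hk : T.IsFlowSolutionOn Lhat (Set.Ici 0) k) {k' : V → ℝ} (hk' : ∀ v, 0 < k' v)
    (h : Tendsto k atTop (𝓝 k')) (v : V) : T.vertexCurvature k' v = Lhat v := by
  have h1 : Tendsto (fun t => Real.log (k t v)) atTop (𝓝 (Real.log (k' v))) :=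
    ((Real.continuousAt_log (hk' v).ne').tendsto).comp (tendsto_pi_nhds.1 h v)
  have h2 : Tendsto (fun t => Lhat v - T.vertexCurvature
      (fun i => Real.exp (Real.log (k t i))) v) atTop (𝓝 (Lhat v - T.vertexCurvature k' v)) := by
    refine tendsto_const_nhds.sub ?_
    refine ((T.contDiffAt_vertexCurvature hk' v).continuousAt.tendsto.comp h).congr' ?_
    filter_upwards [eventually_ge_atTop 0] with t ht
    simp only [Function.comp_apply]
    congr 1
    exact funext fun i => (Real.exp_log (hk t ht i).1).symm
  have := eq_zero_of_tendsto_of_tendsto_deriv (fun t ht => hk.log t ht v) h1 h2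
  linarith

end TriangulatedSurface

/-! ### Return to the original coordinates, types of the circles, and the main theorem -/

lemma abs_exp_sub_exp_le {x y N : ℝ} (h : |x - y| ≤ N) :
    |Real.exp x - Real.exp y| ≤ Real.exp y * Real.exp N * |x - y| := by
  have hxy : Real.exp x = Real.exp y * Real.exp (x - y) := by rw [← Real.exp_add]; ring_nf
  have key : |Real.exp (x - y) - 1| ≤ Real.exp N * |x - y| := by
    obtain ⟨h1, h2⟩ := abs_le.1 h
    generalize x - y = z at *
    have hN : 1 ≤ Real.exp N := Real.one_le_exp ((abs_nonneg z).trans h)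
    rcases le_total 0 z with hz | hz
    · rw [abs_of_nonneg hz, abs_of_nonneg (by linarith [Real.one_le_exp hz])]
      have h3 := mul_le_mul_of_nonneg_right (Real.add_one_le_exp (-z)) (Real.exp_pos z).le
      rw [← Real.exp_add, neg_add_cancel, Real.exp_zero] at h3
      have h4 : Real.exp z * z ≤ Real.exp N * z :=
        mul_le_mul_of_nonneg_right (Real.exp_le_exp.2 h2) hz
      linarith
    · rw [abs_of_nonpos hz, abs_of_nonpos (by linarith [Real.exp_le_one_iff.2 hz])]
      have := Real.add_one_le_exp z
      nlinarith
  have e : Real.exp x - Real.exp y = Real.exp y * (Real.exp (x - y) - 1) := by rw [hxy]; ring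
  rw [e, abs_mul, abs_of_pos (Real.exp_pos y), mul_assoc]
  exact mul_le_mul_of_nonneg_left key (Real.exp_pos y).le

/-- The type sets carry no freedom, so uniqueness of the metric reduces to uniqueness of `k`. -/
lemma IsGeneralizedCirclePackingMetric.eq_setOf {V : Type*} {I₁ I₂ : Set V} {k : V → ℝ}
    (h : IsGeneralizedCirclePackingMetric I₁ I₂ k) :
    I₁ = {i | k i < 1} ∧ I₂ = {i | k i = 1} := by
  constructor
  · ext i
    refine ⟨h.hypercycle i, fun hi => ?_⟩
    by_contra h1
    have hi' : k i < 1 := hi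
    by_cases h2 : i ∈ I₂
    · exact hi'.ne (h.horocycle i h2)
    · exact hi'.not_gt (h.circle i h1 h2)
  · ext i
    refine ⟨h.horocycle i, fun hi => ?_⟩
    by_contra h2
    have hi' : k i = 1 := hi
    by_cases h1 : i ∈ I₁
    · exact (h.hypercycle i h1).ne hi'
    · exact (h.circle i h1 h2).ne' hi'

lemma isGeneralizedCirclePackingMetric_setOf {V : Type*} {k : V → ℝ} (hk : ∀ i, 0 < k i) :
    IsGeneralizedCirclePackingMetric {i | k i < 1} {i | k i = 1} k where
  disjoint := Set.disjoint_left.2 fun _ (h1 : _ < _) (h2 : _ = _) => h1.ne h2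
  pos := hk
  hypercycle _ h := h
  horocycle _ h := h
  circle _ h1 h2 := lt_of_le_of_ne (not_lt.1 h1) (Ne.symm h2)

end

theorem theorem1p3 {V F : Type*} [Fintype V] [Fintype F] (T : TriangulatedSurface V F)
    (Lhat : V → ℝ) (k₀ : V → ℝ) (hk₀ : ∀ i, 0 < k₀ i) :
    ∃ k : ℝ → V → ℝ,
      -- the flow has a solution on `[0, ∞)` with initial vector `k₀`
      k 0 = k₀ ∧ T.IsFlowSolutionOn Lhat (Set.Ici 0) k ∧
      -- every solution with initial vector `k₀` is a restriction of it
      (∀ (b : ℝ) (k' : ℝ → V → ℝ), k' 0 = k₀ → T.IsFlowSolutionOn Lhat (Set.Ico 0 b) k' →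
        Set.EqOn k' k (Set.Ico 0 b)) ∧
      -- it converges if and only if the inequalities hold
      (FlowConverges k ↔
        (∀ i, 0 < Lhat i) ∧
        ∀ I : Finset V, I.Nonempty →
          ∑ i ∈ I, Lhat i < Real.pi * (T.facesMeeting (I : Set V)).ncard) ∧
      -- in that case it converges exponentially fast to the unique metric with curvatures `Lhat`
      (FlowConverges k →
        ∃ (I₁ I₂ : Set V) (khat : V → ℝ),
          IsGeneralizedCirclePackingMetric I₁ I₂ khat ∧
          (∀ i, T.totalGeodesicCurvature khat i = Lhat i) ∧
          (∀ (J₁ J₂ : Set V) (k' : V → ℝ), IsGeneralizedCirclePackingMetric J₁ J₂ k' →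
            (∀ i, T.totalGeodesicCurvature k' i = Lhat i) →
            J₁ = I₁ ∧ J₂ = I₂ ∧ k' = khat) ∧
          ∃ C δ : ℝ, 0 < δ ∧ ∀ t, 0 ≤ t → ∀ i,
            |k t i - khat i| ≤ C * Real.exp (-(δ * t))) := by
  obtain ⟨u, hu0, hu⟩ := T.exists_isLogFlowSolutionOn_Ici Lhat fun v => Real.log (k₀ v)
  have hk := hu.exp
  have hconv : ∀ khat : V → ℝ, (∀ v, 0 < khat v) → (∀ v, T.vertexCurvature khat v = Lhat v) →
      ∃ C δ : ℝ, 0 < δ ∧ ∀ t, 0 ≤ t → ∀ i,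
        |Real.exp (u t i) - khat i| ≤ C * Real.exp (-(δ * t)) := by
    intro khat hpos hL
    have hlog : ∀ v, Real.exp (Real.log (khat v)) = khat v := fun v => Real.exp_log (hpos v)
    obtain ⟨N, δ, hN, hδ, h⟩ := hu.exists_abs_sub_le (w := fun v => Real.log (khat v))
      fun v => by simp only [hlog, hL]
    refine ⟨‖khat‖ * Real.exp N * N, δ, hδ, fun t ht i => ?_⟩
    have h1 : |u t i - Real.log (khat i)| ≤ N := (h t ht i).trans
      (mul_le_of_le_one_right hN.le (Real.exp_le_one_iff.2 (by nlinarith)))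
    have h2 := abs_exp_sub_exp_le h1
    rw [hlog] at h2
    have h3 : khat i ≤ ‖khat‖ := (le_abs_self _).trans (norm_le_pi_norm khat i)
    calc |Real.exp (u t i) - khat i|
        ≤ khat i * Real.exp N * |u t i - Real.log (khat i)| := h2
      _ ≤ ‖khat‖ * Real.exp N * (N * Real.exp (-(δ * t))) := by
          gcongr
          exact h t ht i
      _ = ‖khat‖ * Real.exp N * N * Real.exp (-(δ * t)) := by ring
  -- Limits of the flow are zeros of the field, and any zero attracts this solution; the
  -- inequalities then only have to be matched with the existence of a zero.
  have hiff : FlowConverges (fun t v => Real.exp (u t v)) ↔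
      ∃ khat : V → ℝ, (∀ v, 0 < khat v) ∧ ∀ v, T.vertexCurvature khat v = Lhat v := by
    constructor
    · rintro ⟨k', hk', h⟩
      exact ⟨k', hk', hk.vertexCurvature_eq_of_tendsto hk' h⟩
    · rintro ⟨khat, hpos, hL⟩
      obtain ⟨C, δ, hδ, h⟩ := hconv khat hpos hL
      refine ⟨khat, hpos, tendsto_pi_nhds.2 fun i => ?_⟩
      rw [tendsto_iff_norm_sub_tendsto_zero]
      have hlim : Tendsto (fun t : ℝ => C * Real.exp (-(δ * t))) atTop (𝓝 0) := by
        simpa using (Real.tendsto_exp_neg_atTop_nhds_zero.comp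
          (tendsto_id.const_mul_atTop hδ)).const_mul C
      refine squeeze_zero' (Eventually.of_forall fun _ => norm_nonneg _) ?_ hlim
      filter_upwards [eventually_ge_atTop 0] with t ht using h t ht i
  refine ⟨fun t v => Real.exp (u t v), ?_, hk, ?_, ?_, ?_⟩
  · funext v
    simp only [hu0, Real.exp_log (hk₀ v)]
  · intro b k' h0 hk' t ht
    have := hk'.log.eqOn (hu.mono fun s hs => hs.1) (by rw [hu0, h0]) ht
    funext v
    simp only [← this]
    exact (Real.exp_log (hk' t ht v).1).symm
  · rw [hiff]
    constructor
    · rintro ⟨khat, hpos, hL⟩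
      refine ⟨fun v => hL v ▸ T.vertexCurvature_pos hpos v, fun I hI => ?_⟩
      simpa only [hL] using T.sum_vertexCurvature_lt hpos hI
    · exact fun h => T.exists_vertexCurvature_eq h.1 h.2
  · intro hc
    obtain ⟨khat, hpos, hL⟩ := hiff.1 hc
    refine ⟨_, _, khat, isGeneralizedCirclePackingMetric_setOf hpos,
      fun v => (T.totalGeodesicCurvature_eq hpos v).trans (hL v), fun J₁ J₂ k' hJ hk' => ?_,
      hconv khat hpos hL⟩
    have : k' = khat := T.eq_of_vertexCurvature_eq hJ.pos hpos fun v => by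
      rw [← T.totalGeodesicCurvature_eq hJ.pos, hk', hL]
    subst this
    exact ⟨hJ.eq_setOf.1, hJ.eq_setOf.2, rfl⟩
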